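/- Let $S=\mathbb{C}[x_0,x_1,x_2,x_3]$ and let $D: f=0$ be a reduced surface in $\mathbb{P}^3$, where $f\in S$ is homogeneous of degree $d$. Let $f_i=\partial f/\partial x_i$, let $J_f=(f_0,f_1,f_2,f_3)$ be the Jacobian ideal, let $\Sigma\subset\mathbb{P}^3$ be the singular subscheme defined by $J_f$, and assume $\dim\Sigma=1$. The degree of $\Sigma$ is $m!\,a$, where $m$ and $a$ are the degree and the leading coefficient of the Hilbert polynomial of the graded algebra $S/J_f$ (so $m=1$ and $\deg\Sigma=a$). Let $AR(f)=\{\rho\in S^4 : \sum_i\rho_i f_i=0\}$ be the graded module of Jacobian syzygies, where $\rho$ has degree $q$ if all $\rho_i$ are homogeneous of degree $q$; assume that $AR(f)$ has no nonzero element of degree $0$ (that is, $D$ is not a cone). Let $e_1$ be the minimal degree of a nonzero homogeneous syzygy. For such a syzygy $\rho_1$ of degree $e_1$, let $\rho_2\in AR(f)$ be homogeneous and such that its class is a nonzero homogeneous element of minimal degree $e_2$ in $AR(f)/S\rho_1$; then $e_1\le e_2$. For $\rho\in S^4$ put $\omega(\rho)=\sum_i\rho_i\,dx_i$. The surface $D$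 is tame if $\rho_1,\rho_2$ as above can be chosen so that the sequence $$S\oplus S\xrightarrow{\ (a,b)\mapsto a\rho_1+b\rho_2\ } AR(f)\xrightarrow{\ \rho\mapsto\omega(\rho_1)\wedge\omega(\rho_2)\wedge\omega(\rho)\ }\Omega^3$$ is exact at $AR(f)$, where $\Omega^3$ is the $S$-module of algebraic differential $3$-forms on $\mathbb{C}^4$. The surface $D$ is free if the graded $S$-module $AR(f)$ is isomorphic to $S(-d_1)\oplus S(-d_2)\oplus S(-d_3)$ for some positive integers $d_1\le d_2\le d_3$. Suppose that $D$ is tame, with syzygy degrees $e_1\le e_2$ satisfying $e_1+2e_2\le d-1$, and set $e_3=d-1-e_1-e_2$. Then $$\deg\Sigma\le s_1^2-s_2,$$ where $s_1=e_1+e_2+e_3$ and $s_2=e_1e_2+e_1e_3+e_2e_3$. Moreover, equality holds if and only if $D$ is free. -/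

import Mathlib

open MvPolynomial

noncomputable section

namespace FreeSurface

attribute [local instance] MvPolynomial.gradedAlgebra

/-- The polynomial ring `S = ℂ[x₀, x₁, x₂, x₃]`, the homogeneous coordinate ring of `ℙ³`. -/
abbrev S : Type := MvPolynomial (Fin 4) ℂ

/-- The Jacobian ideal `J_f`, generated by the four first order partial derivatives of `f`. -/
def jacobianIdeal (f : S) : Ideal S :=
  Ideal.span (Set.range fun i : Fin 4 => pderiv i f)

/-- The Milnor (Jacobian) algebra `M(f) = S / J_f`. -/
abbrev MilnorAlgebra (f : S) : Type := S ⧸ jacobianIdeal f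

/-- The homogeneous component `M(f)_k`, the image of `S_k` in `M(f)`. -/
def milnorComponent (f : S) (k : ℕ) : Submodule ℂ (MilnorAlgebra f) :=
  (homogeneousSubmodule (Fin 4) ℂ k).map
    (Ideal.Quotient.mkₐ ℂ (jacobianIdeal f)).toLinearMap

/-- The underlying closed subset of `ℙ³ = Proj S` of the singular subscheme `Σ` of `f = 0`,
that is, the zero locus of the Jacobian ideal. -/
def singularLocus (f : S) : Set (ProjectiveSpectrum (homogeneousSubmodule (Fin 4) ℂ)) :=
  ProjectiveSpectrum.zeroLocus (homogeneousSubmodule (Fin 4) ℂ) (jacobianIdeal f : Set S)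

/-- `P` is the Hilbert polynomial of the Milnor algebra: `dim M(f)_k = P(k)` for all large `k`. -/
def IsHilbertPolynomial (f : S) (P : Polynomial ℚ) : Prop :=
  ∃ N : ℕ, ∀ k : ℕ, N ≤ k → (Module.finrank ℂ (milnorComponent f k) : ℚ) = P.eval (k : ℚ)

/-- `δ` is the degree of the singular subscheme `Σ` of `f = 0`: it is `m! * a`, where `m` is the
degree and `a` the leading coefficient of the Hilbert polynomial of `M(f)`. -/
def IsSingularDegree (f : S) (δ : ℚ) : Prop :=
  ∃ P : Polynomial ℚ, IsHilbertPolynomial f P ∧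
    δ = (P.natDegree.factorial : ℚ) * P.leadingCoeff

/-- The degree of the singular subscheme is unique. -/
theorem IsSingularDegree.unique {f : S} {δ δ' : ℚ}
    (h : IsSingularDegree f δ) (h' : IsSingularDegree f δ') : δ = δ' := by
  obtain ⟨P, ⟨N, hN⟩, rfl⟩ := h
  obtain ⟨Q, ⟨N', hN'⟩, rfl⟩ := h'
  have hPQ : P = Q := by
    refine Polynomial.eq_of_infinite_eval_eq P Q ?_
    refine Set.Infinite.mono (s := (fun k : ℕ => (k : ℚ)) '' Set.Ici (max N N')) ?_ ?_
    · rintro _ ⟨k, hk, rfl⟩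
      have hk' : max N N' ≤ k := hk
      show P.eval (k : ℚ) = Q.eval (k : ℚ)
      rw [← hN k (le_trans (le_max_left _ _) hk'), ← hN' k (le_trans (le_max_right _ _) hk')]
    · exact (Set.Ici_infinite _).image (Nat.cast_injective.injOn)
  rw [hPQ]

/-- The module `AR(f) ⊆ S⁴` of all Jacobian syzygies of `f`: the quadruples `ρ` with
`∑ ρ_i f_i = 0`. -/
def AR (f : S) : Submodule S (Fin 4 → S) where
  carrier := {ρ | ∑ i, ρ i * pderiv i f = 0}
  zero_mem' := by simp
  add_mem' := by
    intro a b ha hb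
    simp only [Set.mem_ofPred_eq, Pi.add_apply, add_mul, Finset.sum_add_distrib] at *
    rw [ha, hb, add_zero]
  smul_mem' := by
    intro c a ha
    simp only [Set.mem_ofPred_eq, Pi.smul_apply, smul_eq_mul, mul_assoc] at *
    rw [← Finset.mul_sum, ha, mul_zero]

/-- The vector `ρ ∈ S⁴` is homogeneous of degree `q`: all its components lie in `S_q`. -/
def IsHomogeneousVec (ρ : Fin 4 → S) (q : ℕ) : Prop :=
  ∀ i, (ρ i).IsHomogeneous q

/-- `e₁` is `mdr(f)`, the minimal degree of a nontrivial Jacobian relation of `f`. -/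
def IsMdr (f : S) (e₁ : ℕ) : Prop :=
  IsLeast {q : ℕ | ∃ ρ ∈ AR f, ρ ≠ 0 ∧ IsHomogeneousVec ρ q} e₁

/-- `ρ₁` is a nonzero homogeneous syzygy of minimal degree `e₁`, and `ρ₂` is a homogeneous syzygy
whose class in `AR(f) / S ρ₁` is a nonzero homogeneous element of minimal degree `e₂`. -/
structure IsMinimalPair (f : S) (e₁ e₂ : ℕ) (ρ₁ ρ₂ : AR f) : Prop where
  mdr : IsMdr f e₁
  ne_zero : ρ₁ ≠ 0
  homogeneous₁ : IsHomogeneousVec (ρ₁ : Fin 4 → S) e₁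
  not_mem : ρ₂ ∉ Submodule.span S {ρ₁}
  homogeneous₂ : IsHomogeneousVec (ρ₂ : Fin 4 → S) e₂
  minimal : ∀ (q : ℕ) (ρ : AR f), IsHomogeneousVec (ρ : Fin 4 → S) q →
    ρ ∉ Submodule.span S {ρ₁} → e₂ ≤ q

/-- The map `u : S ⊕ S → AR(f)`, `(a, b) ↦ a ρ₁ + b ρ₂`. -/
def mapU {f : S} (ρ₁ ρ₂ : AR f) : (S × S) →ₗ[S] AR f :=
  (LinearMap.toSpanSingleton S (AR f) ρ₁).coprod (LinearMap.toSpanSingleton S (AR f) ρ₂)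

/-- The map `v : ρ ↦ ω(ρ₁) ∧ ω(ρ₂) ∧ ω(ρ)`. The algebraic differential forms on `ℂ⁴` are the
exterior algebra over `S` of the free module `Ω¹ = S⁴` with basis `dx₀, …, dx₃`, and
`ω(ρ) = ∑ ρ_i dx_i` corresponds to the vector `ρ` itself. -/
def mapV {f : S} (ρ₁ ρ₂ : AR f) : AR f →ₗ[S] ExteriorAlgebra S (Fin 4 → S) :=
  (LinearMap.mulLeft S
    (ExteriorAlgebra.ι S (ρ₁ : Fin 4 → S) * ExteriorAlgebra.ι S (ρ₂ : Fin 4 → S))) ∘ₗ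
      (ExteriorAlgebra.ι S) ∘ₗ (AR f).subtype

/-- The surface `f = 0` is tame, and the degrees of the pair of syzygies involved are `e₁`, `e₂`:
for some pair `ρ₁, ρ₂` as above, the sequence `S ⊕ S → AR(f) → Ω³` is exact. -/
def IsTame (f : S) (e₁ e₂ : ℕ) : Prop :=
  ∃ ρ₁ ρ₂ : AR f, IsMinimalPair f e₁ e₂ ρ₁ ρ₂ ∧ Function.Exact (mapU ρ₁ ρ₂) (mapV ρ₁ ρ₂)

/-- The surface `f = 0` is free: the graded module `AR(f)` is isomorphic to
`S(-d₁) ⊕ S(-d₂) ⊕ S(-d₃)` for some positive integers `d₁ ≤ d₂ ≤ d₃`, that is, it has a basis of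
three homogeneous elements of these degrees. -/
def IsFree (f : S) : Prop :=
  ∃ (n : Fin 3 → ℕ) (b : Module.Basis (Fin 3) S (AR f)),
    (∀ i, 0 < n i) ∧ Monotone n ∧ ∀ i, IsHomogeneousVec (b i : Fin 4 → S) (n i)

end FreeSurface

end

noncomputable section

namespace FreeSurface

attribute [local instance] MvPolynomial.gradedAlgebra

/-! ### Homogeneous polynomials -/

/-! The maximal minors of three syzygies form a vector proportional to the gradient of `f`. Since
`f` is squarefree, the partial derivatives have no common factor, so the minors of `ρ₁, ρ₂, ρ` equal
`h ρ` times the gradient for an `S`-linear `h : AR f → S` that lowers degrees by `e₃`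
(`exists_contraction`). Tameness says that `ker h` is the span of `ρ₁, ρ₂`, and this span is free.
With `K` the ideal `h(AR f)`, this is an exact sequence `0 → S(-e₁) ⊕ S(-e₂) → AR(f) → K(-e₃) → 0`.

Counting dimensions, `dim M(f)_j` plus the codimension of `K` in degree `j - (d - 1) - e₃` is, for
large `j`, the value expected of a free surface with exponents `e₁, e₂, e₃`. That value is linear in
`j` with slope `s₁² - s₂`. The codimension is nonnegative, so `dim M(f)_j` has at most linear
growth. It is eventually polynomial (`eventuallyPolynomial_hilbertFunction`) and unbounded because
`dim Σ = 1` (`hilbertFunction_unbounded`). Hence its polynomial has degree one, with slope `deg Σ ≤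
s₁² - s₂`.

Equality of slopes means that the codimension of `K` stays bounded. Then `K` contains nonzero binary
forms in any two variables, and this forces `K = S` (`IsContraction.exists_eq_one`): it is an
explicit version of the vanishing of `Ext¹(K, S)` for `K` of grade at least three, combined with the
fact that `aτ ∈ AR(f)`, `a ≠ 0` implies `τ ∈ AR(f)`. A preimage of `1` completes `ρ₁, ρ₂` to a
homogeneous basis. Conversely, for a free surface the two lowest exponents are `e₁, e₂`, and
comparing Hilbert functions shows that the third is `e₃` and that the slopes agree. -/

lemma coeff_homogeneous_injective {k : ℕ} {p q : S} (hp : p.IsHomogeneous k)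
    (hq : q.IsHomogeneous k)
    (h : ∀ m : Fin 4 →₀ ℕ, m.degree = k → coeff m p = coeff m q) : p = q := by
  ext m
  by_cases hm : m.degree = k
  · exact h m hm
  · rw [hp.coeff_eq_zero hm, hq.coeff_eq_zero hm]

/-- The exponents of degree `k`. -/
def exponents (k : ℕ) : Finset (Fin 4 →₀ ℕ) := Finset.univ.finsuppAntidiag k

lemma mem_exponents {k : ℕ} {m : Fin 4 →₀ ℕ} : m ∈ exponents k ↔ m.degree = k := by
  simp [exponents, Finset.mem_finsuppAntidiag, Finsupp.degree_eq_sum]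

/-- A homogeneous polynomial is given by its coefficients. -/
def coeffEquiv (k : ℕ) : homogeneousSubmodule (Fin 4) ℂ k ≃ₗ[ℂ] (exponents k → ℂ) :=
  LinearEquiv.ofBijective
    (LinearMap.pi fun m : exponents k => (lcoeff ℂ (m : Fin 4 →₀ ℕ)) ∘ₗ
      (homogeneousSubmodule (Fin 4) ℂ k).subtype) <| by
    constructor
    · intro p q h
      refine Subtype.ext (coeff_homogeneous_injective p.2 q.2 fun m hm => ?_)
      exact congrFun h ⟨m, mem_exponents.2 hm⟩
    · intro c
      refine ⟨⟨∑ m : exponents k, monomial (m : Fin 4 →₀ ℕ) (c m), ?_⟩, ?_⟩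
      · exact Submodule.sum_mem _ fun m _ =>
          isHomogeneous_monomial _ (mem_exponents.1 m.2)
      · ext m
        simp only [LinearMap.pi_apply, LinearMap.comp_apply, Submodule.subtype_apply,
          lcoeff_apply, coeff_sum, coeff_monomial, Subtype.coe_inj]
        simp

instance (k : ℕ) : FiniteDimensional ℂ (homogeneousSubmodule (Fin 4) ℂ k) :=
  Module.Finite.equiv (coeffEquiv k).symm

lemma finrank_homogeneousSubmodule (k : ℕ) :
    Module.finrank ℂ (homogeneousSubmodule (Fin 4) ℂ k) = (k + 3).choose 3 := by
  rw [(coeffEquiv k).finrank_eq, Module.finrank_fintype_fun_eq_card, Fintype.card_coe, exponents,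
    Finset.card_finsuppAntidiag_nat_eq_choose, Finset.card_univ, Fintype.card_fin,
    show 4 + k - 1 = k + 3 by omega, ← Nat.choose_symm (by omega)]
  congr 1
  omega

lemma sum_homogeneousComponent_of_le {p : S} {N : ℕ} (h : p.totalDegree < N) :
    ∑ i ∈ Finset.range N, homogeneousComponent i p = p := by
  conv_rhs => rw [← sum_homogeneousComponent p]
  symm
  refine Finset.sum_subset (Finset.range_mono h) fun i _ hi => ?_
  exact homogeneousComponent_eq_zero _ _ (by simpa using hi)

lemma homogeneousComponent_homogeneous_mul {a : S} {e : ℕ} (ha : a.IsHomogeneous e) (g : S)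
    (n : ℕ) : homogeneousComponent n (a * g) =
      if e ≤ n then a * homogeneousComponent (n - e) g else 0 := by
  have key : ∀ i, homogeneousComponent n (a * homogeneousComponent i g) =
      if n = e + i then a * homogeneousComponent i g else 0 := fun i =>
    homogeneousComponent_of_mem (ha.mul (homogeneousComponent_isHomogeneous i g))
  conv_lhs => rw [← sum_homogeneousComponent_of_le (p := g)
    (N := g.totalDegree + n + 1) (by omega), Finset.mul_sum, map_sum]
  simp_rw [key]
  split_ifs with h
  · rw [Finset.sum_eq_single (n - e)]
    · rw [if_pos (by omega)]
    · intro i _ hi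
      rw [if_neg (by omega)]
    · intro hi
      simp at hi
      omega
  · exact Finset.sum_eq_zero fun i _ => if_neg (by omega)

lemma homogeneousComponent_add_mul {a : S} {e : ℕ} (ha : a.IsHomogeneous e) (g : S) (n : ℕ) :
    homogeneousComponent (e + n) (a * g) = a * homogeneousComponent n g := by
  rw [homogeneousComponent_homogeneous_mul ha, if_pos (by omega), Nat.add_sub_cancel_left]

lemma isHomogeneous_of_component {p : S} {k : ℕ}
    (h : ∀ j, j ≠ k → homogeneousComponent j p = 0) : p.IsHomogeneous k := by
  rw [← sum_homogeneousComponent p]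
  refine IsHomogeneous.sum _ _ _ fun i _ => ?_
  by_cases hi : i = k
  · exact hi ▸ homogeneousComponent_isHomogeneous i p
  · rw [h i hi]
    exact isHomogeneous_zero _ _ _

/-- A cofactor of a homogeneous product has the expected degree. -/
lemma homogeneousComponent_cofactor {a g : S} {e n j : ℕ} (ha : a.IsHomogeneous e) (ha0 : a ≠ 0)
    (h : (a * g).IsHomogeneous n) (hj : e + j ≠ n) : homogeneousComponent j g = 0 := by
  have h1 := homogeneousComponent_add_mul ha g j
  rw [homogeneousComponent_of_mem h, if_neg hj] at h1
  exact (mul_eq_zero.1 h1.symm).resolve_left ha0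

/-! ### Linear algebra -/

lemma finrank_map_add_finrank_inf_ker {V W : Type*} [AddCommGroup V] [Module ℂ V]
    [AddCommGroup W] [Module ℂ W] (p : Submodule ℂ V) [FiniteDimensional ℂ p] (φ : V →ₗ[ℂ] W) :
    Module.finrank ℂ (p.map φ) + Module.finrank ℂ (p ⊓ LinearMap.ker φ : Submodule ℂ V) =
      Module.finrank ℂ p := by
  have h := (φ.domRestrict p).finrank_range_add_finrank_ker
  rw [LinearMap.range_domRestrict, LinearMap.ker_domRestrict] at h
  rw [← h]
  congr 1
  rw [LinearEquiv.finrank_eq (Submodule.equivMapOfInjective p.subtype p.injective_subtype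
    (Submodule.comap p.subtype (LinearMap.ker φ))), Submodule.map_comap_subtype]

/-! ### Hilbert functions of homogeneous ideals -/

/-- A polynomial ideal closed under taking homogeneous components. -/
def IsHomogeneousIdeal (I : Ideal S) : Prop := ∀ g ∈ I, ∀ n, homogeneousComponent n g ∈ I

/-- The homogeneous component of degree `k` of an ideal. -/
def idealComponent (I : Ideal S) (k : ℕ) : Submodule ℂ S :=
  homogeneousSubmodule (Fin 4) ℂ k ⊓ I.restrictScalars ℂ

/-- The Hilbert function of `S / I`. -/
def hilbertFunction (I : Ideal S) (k : ℕ) : ℕ :=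
  Module.finrank ℂ ((homogeneousSubmodule (Fin 4) ℂ k).map (Ideal.Quotient.mkₐ ℂ I).toLinearMap)

instance (I : Ideal S) (k : ℕ) : FiniteDimensional ℂ (idealComponent I k) :=
  Submodule.finiteDimensional_inf_left _ _

lemma mem_idealComponent {I : Ideal S} {k : ℕ} {g : S} :
    g ∈ idealComponent I k ↔ g.IsHomogeneous k ∧ g ∈ I := Iff.rfl

lemma hilbertFunction_add (I : Ideal S) (k : ℕ) :
    hilbertFunction I k + Module.finrank ℂ (idealComponent I k) = (k + 3).choose 3 := by
  rw [← finrank_homogeneousSubmodule]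
  have : idealComponent I k = homogeneousSubmodule (Fin 4) ℂ k ⊓
      LinearMap.ker (Ideal.Quotient.mkₐ ℂ I).toLinearMap := by
    ext g
    simp [mem_idealComponent, LinearMap.mem_ker, Ideal.Quotient.eq_zero_iff_mem]
  rw [this]
  exact finrank_map_add_finrank_inf_ker _ _

lemma hilbertFunction_anti {I J : Ideal S} (h : I ≤ J) (k : ℕ) :
    hilbertFunction J k ≤ hilbertFunction I k := by
  have h1 := hilbertFunction_add I k
  have h2 := hilbertFunction_add J k
  have h3 : Module.finrank ℂ (idealComponent I k) ≤ Module.finrank ℂ (idealComponent J k) :=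
    Submodule.finrank_mono fun g hg => ⟨hg.1, h hg.2⟩
  omega

/-- The ideal quotient `I : a`. -/
def colonIdeal (I : Ideal S) (a : S) : Ideal S := Submodule.comap (LinearMap.mulLeft S a) I

lemma mem_colonIdeal {I : Ideal S} {a g : S} : g ∈ colonIdeal I a ↔ a * g ∈ I := Iff.rfl

lemma le_colonIdeal (I : Ideal S) (a : S) : I ≤ colonIdeal I a := fun _ hg => I.mul_mem_left a hg

lemma IsHomogeneousIdeal.colon {I : Ideal S} (hI : IsHomogeneousIdeal I) {a : S} {e : ℕ}
    (ha : a.IsHomogeneous e) : IsHomogeneousIdeal (colonIdeal I a) := fun g hg n => by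
  rw [mem_colonIdeal, ← homogeneousComponent_add_mul ha]
  exact hI _ hg _

lemma IsHomogeneousIdeal.sup_span {I : Ideal S} (hI : IsHomogeneousIdeal I) {a : S} {e : ℕ}
    (ha : a.IsHomogeneous e) : IsHomogeneousIdeal (I ⊔ Ideal.span {a}) := fun g hg n => by
  obtain ⟨y, hy, z, hz, rfl⟩ := Submodule.mem_sup.1 hg
  obtain ⟨w, rfl⟩ := Ideal.mem_span_singleton'.1 hz
  rw [map_add, mul_comm w, homogeneousComponent_homogeneous_mul ha]
  refine Submodule.add_mem_sup (hI y hy n) ?_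
  split_ifs
  · exact Ideal.mul_mem_right _ _ (Ideal.mem_span_singleton_self a)
  · exact zero_mem _

/-- Multiplication by a homogeneous `a` gives
`0 → (S / (I : a))(-e) → S / I → S / (I + (a)) → 0`. -/
lemma hilbertFunction_mul {I : Ideal S} (hI : IsHomogeneousIdeal I) {a : S} {e : ℕ}
    (ha : a.IsHomogeneous e) (ha0 : a ≠ 0) (k : ℕ) :
    hilbertFunction I (e + k) =
      hilbertFunction (I ⊔ Ideal.span {a}) (e + k) + hilbertFunction (colonIdeal I a) k := by
  have hinj : Function.Injective (LinearMap.mulLeft ℂ a) := fun x y h => mul_left_cancel₀ ha0 h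
  -- `T = a S_k` meets `I` in `a (I : a)_k` and together with `I` spans `(I + (a))` in degree `e +
  -- k`; the count is the dimension formula for a sum of two subspaces.
  set T := (homogeneousSubmodule (Fin 4) ℂ k).map (LinearMap.mulLeft ℂ a) with hT
  have hTf : Module.finrank ℂ T = (k + 3).choose 3 := by
    rw [← finrank_homogeneousSubmodule]
    exact (Submodule.equivMapOfInjective _ hinj _).finrank_eq.symm
  have hinf : Module.finrank ℂ (idealComponent I (e + k) ⊓ T : Submodule ℂ S) =
      Module.finrank ℂ (idealComponent (colonIdeal I a) k) := by
    rw [LinearEquiv.finrank_eq (Submodule.equivMapOfInjective _ hinj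
      (idealComponent (colonIdeal I a) k))]
    suffices idealComponent I (e + k) ⊓ T =
        (idealComponent (colonIdeal I a) k).map (LinearMap.mulLeft ℂ a) by rw [this]
    ext g
    constructor
    · rintro ⟨⟨_, h2⟩, ⟨w, hw, rfl⟩⟩
      exact ⟨w, ⟨hw, h2⟩, rfl⟩
    · rintro ⟨w, ⟨hw, h2⟩, rfl⟩
      exact ⟨⟨ha.mul hw, h2⟩, ⟨w, hw, rfl⟩⟩
  have hsup : idealComponent I (e + k) ⊔ T = idealComponent (I ⊔ Ideal.span {a}) (e + k) := by
    apply le_antisymm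
    · refine sup_le (fun g hg => ⟨hg.1, Ideal.mem_sup_left hg.2⟩) ?_
      rintro _ ⟨w, hw, rfl⟩
      exact ⟨ha.mul hw, Ideal.mem_sup_right
        (Ideal.mul_mem_right _ _ (Ideal.mem_span_singleton_self a))⟩
    · rintro g ⟨hg, hg2⟩
      obtain ⟨y, hy, z, hz, rfl⟩ := Submodule.mem_sup.1 hg2
      obtain ⟨w, rfl⟩ := Ideal.mem_span_singleton'.1 hz
      rw [← homogeneousComponent_eq_self hg, map_add, mul_comm w,
        homogeneousComponent_add_mul ha]
      exact Submodule.add_mem_sup ⟨homogeneousComponent_isHomogeneous _ _, hI y hy _⟩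
        ⟨_, homogeneousComponent_isHomogeneous _ _, rfl⟩
  have h0 := Submodule.finrank_sup_add_finrank_inf_eq (idealComponent I (e + k)) T
  rw [hsup, hinf, hTf] at h0
  have h1 := hilbertFunction_add I (e + k)
  have h2 := hilbertFunction_add (I ⊔ Ideal.span {a}) (e + k)
  have h3 := hilbertFunction_add (colonIdeal I a) k
  omega

/-! ### Existence of the Hilbert polynomial -/

/-- A sequence of naturals which is eventually polynomial. -/
def EventuallyPolynomial (u : ℕ → ℕ) : Prop :=
  ∃ (P : Polynomial ℚ) (N : ℕ), ∀ k, N ≤ k → (u k : ℚ) = P.eval (k : ℚ)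

lemma exists_polynomial_sum (P : Polynomial ℚ) :
    ∃ Q : Polynomial ℚ, ∀ n : ℕ, ∑ i ∈ Finset.range n, P.eval (i : ℚ) = Q.eval (n : ℚ) := by
  induction P using Polynomial.induction_on' with
  | add p q hp hq =>
    obtain ⟨Q₁, h₁⟩ := hp
    obtain ⟨Q₂, h₂⟩ := hq
    exact ⟨Q₁ + Q₂, fun n => by simp [Finset.sum_add_distrib, h₁, h₂]⟩
  | monomial p c =>
    refine ⟨Polynomial.C c * ∑ i ∈ Finset.range (p + 1),
      Polynomial.C (bernoulli i * ((p + 1).choose i) / (p + 1)) * Polynomial.X ^ (p + 1 - i),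
      fun n => ?_⟩
    simp only [Polynomial.eval_monomial, ← Finset.mul_sum, sum_range_pow, Polynomial.eval_mul,
      Polynomial.eval_C, Polynomial.eval_finsetSum, Polynomial.eval_pow, Polynomial.eval_X]
    congr 1
    exact Finset.sum_congr rfl fun i _ => by ring

/-- Past some `N`, `u` is a constant plus partial sums of a polynomial, which are polynomial by
Faulhaber's formula. -/
lemma EventuallyPolynomial.of_succ {u v : ℕ → ℕ} (hv : EventuallyPolynomial v)
    (h : ∀ k, u (k + 1) = v (k + 1) + u k) : EventuallyPolynomial u := by
  obtain ⟨P, N, hP⟩ := hv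
  obtain ⟨Q, hQ⟩ := exists_polynomial_sum P
  -- `Q n` sums `P` over `i < n`, so the sum over `N < i ≤ k` is `Q k + P k - Q N - P N`.
  refine ⟨Q + Polynomial.C ((u N : ℚ) - Q.eval (N : ℚ)) + P - Polynomial.C (P.eval (N : ℚ)),
    N, fun k hk => ?_⟩
  induction k, hk using Nat.le_induction with
  | base => simp
  | succ k hk ih =>
    have h1 := hP (k + 1) (by omega)
    have h2 := hQ (k + 1)
    rw [Finset.sum_range_succ, hQ] at h2
    simp only [Polynomial.eval_add, Polynomial.eval_sub, Polynomial.eval_C] at ih ⊢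
    rw [h, ← h2]
    push_cast at h1 ⊢
    rw [ih, h1]
    ring

lemma EventuallyPolynomial.of_succ_add {u v w : ℕ → ℕ} (hv : EventuallyPolynomial v)
    (hw : EventuallyPolynomial w) (h : ∀ k, u (k + 1) = v (k + 1) + w k) :
    EventuallyPolynomial u := by
  obtain ⟨P, N, hP⟩ := hv
  obtain ⟨Q, M, hQ⟩ := hw
  refine ⟨P + Q.comp (Polynomial.X - 1), N + M + 1, fun k hk => ?_⟩
  obtain ⟨k, rfl⟩ : ∃ j, k = j + 1 := ⟨k - 1, by omega⟩
  rw [h]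
  push_cast
  have h1 := hP (k + 1) (by omega)
  rw [h1, hQ k (by omega)]
  simp

lemma mem_of_forall_X_mem {I : Ideal S} (h : ∀ i, (X i : S) ∈ I) {g : S} {k : ℕ} (hk : k ≠ 0)
    (hg : g.IsHomogeneous k) : g ∈ I := by
  rw [g.as_sum]
  refine Ideal.sum_mem _ fun m hm => ?_
  have hd : m.degree = k := by
    by_contra hne
    exact (mem_support_iff.1 hm) (hg.coeff_eq_zero hne)
  obtain ⟨i, hi⟩ : ∃ i, m i ≠ 0 := by
    by_contra! hall
    apply hk
    rw [← hd, Finsupp.degree_eq_sum]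
    simp [hall]
  rw [show monomial m (coeff m g) = X i * monomial (m - Finsupp.single i 1) (coeff m g) by
    rw [X, monomial_mul, one_mul, add_tsub_cancel_of_le]
    simpa [Finsupp.single_le_iff] using Nat.one_le_iff_ne_zero.2 hi]
  exact I.mul_mem_right _ (h i)

/-- Hilbert's theorem for homogeneous ideals in four variables. -/
theorem eventuallyPolynomial_hilbertFunction (I : Ideal S) (hI : IsHomogeneousIdeal I) :
    EventuallyPolynomial (hilbertFunction I) := by
  -- Noetherian induction from larger ideals to smaller ones. If some `x_i ∉ I`, then `I + (x_i)` is
  -- strictly larger, and `I : x_i` either is strictly larger or equals `I`; in the latter case the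
  -- recursion is a summation.
  induction I using IsNoetherian.induction with
  | hgt I ih =>
    by_cases h : ∀ i, (X i : S) ∈ I
    · refine ⟨0, 1, fun k hk => ?_⟩
      have h1 := hilbertFunction_add I k
      rw [← finrank_homogeneousSubmodule, show idealComponent I k = homogeneousSubmodule _ ℂ k from
        le_antisymm inf_le_left fun g hg => ⟨hg, mem_of_forall_X_mem h (by omega) hg⟩] at h1
      simpa using h1
    · push Not at h
      obtain ⟨i, hi⟩ := h
      have hX := isHomogeneous_X ℂ i
      have hrec : ∀ k, hilbertFunction I (k + 1) = hilbertFunction (I ⊔ Ideal.span {X i}) (k + 1) +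
          hilbertFunction (colonIdeal I (X i)) k := fun k => by
        rw [add_comm k 1]
        exact hilbertFunction_mul hI hX (X_ne_zero i) k
      have hsup : EventuallyPolynomial (hilbertFunction (I ⊔ Ideal.span {X i})) := by
        refine ih _ (lt_of_le_of_ne le_sup_left fun he => hi ?_) (hI.sup_span hX)
        rw [he]
        exact Ideal.mem_sup_right (Ideal.mem_span_singleton_self _)
      by_cases hc : colonIdeal I (X i) = I
      · rw [hc] at hrec
        exact hsup.of_succ hrec
      · exact hsup.of_succ_add
          (ih _ (lt_of_le_of_ne (le_colonIdeal _ _) (Ne.symm hc)) (hI.colon hX)) hrec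

/-! ### The dimension of the singular locus and the growth of the Hilbert function -/

lemma one_le_hilbertFunction {I : Ideal S} {k : ℕ} {g : S} (hg : g.IsHomogeneous k) (hgI : g ∉ I) :
    1 ≤ hilbertFunction I k := by
  have h1 := hilbertFunction_add I k
  rw [← finrank_homogeneousSubmodule] at h1
  have h2 : Module.finrank ℂ (idealComponent I k) <
      Module.finrank ℂ (homogeneousSubmodule (Fin 4) ℂ k) :=
    Submodule.finrank_lt_finrank_of_lt
      (lt_of_le_of_ne inf_le_left fun h => hgI (h.symm.le (show g ∈ _ from hg)).2)
  omega

lemma exists_X_notMem (p : ProjectiveSpectrum (homogeneousSubmodule (Fin 4) ℂ)) :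
    ∃ i, (X i : S) ∉ p.asHomogeneousIdeal.toIdeal := by
  by_contra! h
  refine p.not_irrelevant_le fun g hg => ?_
  have hg0 : homogeneousComponent 0 g = 0 := by
    have := (HomogeneousIdeal.mem_irrelevant_iff _ g).1 hg
    rw [GradedRing.proj_apply] at this
    rw [← this]
    exact (decomposition.decompose'_apply g 0).symm
  change g ∈ p.asHomogeneousIdeal.toIdeal
  rw [← sum_homogeneousComponent g]
  refine Ideal.sum_mem _ fun n _ => ?_
  by_cases hn : n = 0
  · rw [hn, hg0]
    exact zero_mem _
  · exact mem_of_forall_X_mem h hn (homogeneousComponent_isHomogeneous n g)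

lemma one_le_hilbertFunction_point (p : ProjectiveSpectrum (homogeneousSubmodule (Fin 4) ℂ))
    (k : ℕ) : 1 ≤ hilbertFunction p.asHomogeneousIdeal.toIdeal k := by
  obtain ⟨i, hi⟩ := exists_X_notMem p
  exact one_le_hilbertFunction (isHomogeneous_X_pow i k) fun h => hi (p.isPrime.mem_of_pow_mem k h)

/-- If the zero locus of `J` has a chain of two irreducible closed subsets, then the Hilbert
function of `S / J` is unbounded. -/
theorem hilbertFunction_unbounded {J : Ideal S}
    (hdim : 1 ≤ topologicalKrullDim
      (ProjectiveSpectrum.zeroLocus (homogeneousSubmodule (Fin 4) ℂ) (J : Set S)))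
    (C N : ℕ) : ∃ k, N ≤ k ∧ C ≤ hilbertFunction J k := by
  obtain ⟨l, hl⟩ := (Order.le_krullDim_iff (n := 1)).1 (by exact_mod_cast hdim)
  have hlt : l ⟨0, by omega⟩ < l ⟨1, by omega⟩ := l.strictMono (by simp [Fin.lt_def])
  set Z₀ := l ⟨0, by omega⟩
  set Z₁ := l ⟨1, by omega⟩
  obtain ⟨q, hq1, hq0⟩ := Set.exists_of_ssubset (SetLike.coe_ssubset_coe.2 hlt)
  obtain ⟨c, hc, hcZ⟩ := isClosed_induced_iff.1 Z₀.isClosed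
  obtain ⟨s, rfl⟩ := (ProjectiveSpectrum.isClosed_iff_zeroLocus _ _).1 hc
  have hqs : q.1 ∉ ProjectiveSpectrum.zeroLocus (homogeneousSubmodule (Fin 4) ℂ) s := fun h =>
    hq0 (hcZ ▸ h)
  rw [ProjectiveSpectrum.mem_zeroLocus, Set.not_subset] at hqs
  obtain ⟨g', hg's, hg'q⟩ := hqs
  obtain ⟨e, he⟩ : ∃ e, homogeneousComponent e g' ∉ q.1.asHomogeneousIdeal.toIdeal := by
    by_contra! h
    exact hg'q ((mem_iff_homogeneousComponent_mem q.1.asHomogeneousIdeal.isHomogeneous g').2 h)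
  set g := homogeneousComponent e g' with hgdef
  have hg : g.IsHomogeneous e := homogeneousComponent_isHomogeneous e g'
  have hg0 : g ≠ 0 := fun h => he (h ▸ zero_mem _)
  obtain ⟨p, hp⟩ := Z₀.isIrreducible.nonempty
  have hgp : g ∈ p.1.asHomogeneousIdeal.toIdeal := by
    refine homogeneousComponent_mem_of_mem p.1.asHomogeneousIdeal.isHomogeneous ?_ e
    have hp' : p ∈ (Z₀ : Set _) := hp
    rw [← hcZ] at hp'
    exact hp' hg's
  -- The vanishing ideal of `Z₁`. The form `g` vanishes at a point `p` of `Z₀` but not on all of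
  -- `Z₁`, so multiplication by `g` is injective on `S / I` and its cokernel is nonzero in every
  -- degree.
  let I : Ideal S := ⨅ z : {z // z ∈ Z₁}, z.1.1.asHomogeneousIdeal.toIdeal
  have memI : ∀ x, x ∈ I ↔ ∀ z ∈ Z₁, x ∈ z.1.asHomogeneousIdeal.toIdeal := fun x => by
    simp only [I, Ideal.mem_iInf, Subtype.forall]
  have hI : IsHomogeneousIdeal I := fun x hx n => (memI _).2 fun z hz =>
    homogeneousComponent_mem_of_mem z.1.asHomogeneousIdeal.isHomogeneous ((memI x).1 hx z hz) n
  have hJI : J ≤ I := fun x hx => (memI x).2 fun z _ => z.2 hx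
  have hcolon : colonIdeal I g = I := by
    refine le_antisymm (fun x hx => ?_) (le_colonIdeal _ _)
    by_contra hxI
    rw [memI] at hxI
    push Not at hxI
    obtain ⟨r, hr, hxr⟩ := hxI
    -- Irreducibility of `Z₁`: the nonempty open subsets `g ≠ 0` and `x ≠ 0` have a common point.
    obtain ⟨z, hz, hz1, hz2⟩ := Z₁.isIrreducible.isPreirreducible
      _ _ ((ProjectiveSpectrum.isOpen_basicOpen (homogeneousSubmodule (Fin 4) ℂ) (a := g)).preimage
        continuous_subtype_val)
      ((ProjectiveSpectrum.isOpen_basicOpen (homogeneousSubmodule (Fin 4) ℂ) (a := x)).preimage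
        continuous_subtype_val)
      ⟨q, hq1, (ProjectiveSpectrum.mem_basicOpen _ g q.1).2 he⟩
      ⟨r, hr, (ProjectiveSpectrum.mem_basicOpen _ x r.1).2 hxr⟩
    rcases z.1.isPrime.mem_or_mem ((memI _).1 (mem_colonIdeal.1 hx) z hz) with h | h
    · exact (ProjectiveSpectrum.mem_basicOpen _ g z.1).1 hz1 h
    · exact (ProjectiveSpectrum.mem_basicOpen _ x z.1).1 hz2 h
  have hle : I ⊔ Ideal.span {g} ≤ p.1.asHomogeneousIdeal.toIdeal := by
    refine sup_le (fun x hx => (memI x).1 hx p (hlt.le hp)) ?_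
    rw [Ideal.span_singleton_le_iff_mem]
    exact hgp
  have hstep : ∀ k, hilbertFunction I k + 1 ≤ hilbertFunction I (e + k) := fun k => by
    rw [hilbertFunction_mul hI hg hg0 k, hcolon]
    have h1 := one_le_hilbertFunction_point p.1 (e + k)
    have h2 := hilbertFunction_anti hle (e + k)
    omega
  have hgrow : ∀ n, n ≤ hilbertFunction I (e * n + N) := fun n => by
    induction n with
    | zero => exact Nat.zero_le _
    | succ n ih =>
      have := hstep (e * n + N)
      rw [show e * (n + 1) + N = e + (e * n + N) by ring]
      omega
  exact ⟨e * C + N, by omega, (hgrow C).trans (hilbertFunction_anti hJI _)⟩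

/-! ### The partial derivatives of a squarefree form have no common factor -/

lemma eq_C_of_pderiv_eq_zero {p : S} (h : ∀ i, pderiv i p = 0) : p = C (coeff 0 p) := by
  ext m
  rw [coeff_C]
  split_ifs with hm
  · rw [← hm]
  · obtain ⟨i, hi⟩ : ∃ i, m i ≠ 0 := by
      by_contra! hall
      exact hm (Finsupp.ext fun i => (hall i).symm)
    have h1 := congrArg (coeff (m - Finsupp.single i 1)) (h i)
    have hle : Finsupp.single i 1 ≤ m := by
      simpa [Finsupp.single_le_iff] using Nat.one_le_iff_ne_zero.2 hi
    rw [coeff_pderiv, tsub_add_cancel_of_le hle, coeff_zero, mul_eq_zero] at h1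
    refine h1.resolve_right ?_
    exact Nat.cast_add_one_ne_zero _

lemma pderiv_eq_zero_or_totalDegree_lt (p : S) (i : Fin 4) :
    pderiv i p = 0 ∨ (pderiv i p).totalDegree < p.totalDegree := by
  by_cases h : pderiv i p = 0
  · exact Or.inl h
  right
  obtain ⟨m, hm, hmd⟩ := Finset.exists_mem_eq_sup _ (support_nonempty.2 h)
    (fun s : Fin 4 →₀ ℕ => s.sum fun _ e => e)
  have hc : coeff (m + Finsupp.single i 1) p ≠ 0 := fun h0 => by
    rw [mem_support_iff, coeff_pderiv, h0, zero_mul] at hm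
    exact hm rfl
  have hle := le_totalDegree (mem_support_iff.2 hc)
  rw [Finsupp.sum_add_index' (by simp) (by simp)] at hle
  simp only [Finsupp.sum_single_index] at hle
  rw [totalDegree, hmd]
  omega

/-- Euler's formula gives `π ∣ f`, say `f = π g`. If `π ∣ g`, then `π²` divides `f`. Otherwise `π`
divides its own partial derivatives, which have smaller degree and hence vanish, so `π` is constant.
-/
lemma false_of_irreducible_dvd_pderiv {f : S} {d : ℕ} (hf : f.IsHomogeneous d) (hd : d ≠ 0)
    (hred : Squarefree f) {π : S} (hπ : ∀ i, π ∣ pderiv i f) (hirr : Irreducible π) : False := by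
  have hprime : Prime π := hirr.prime
  have hπf : π ∣ f := by
    have h1 : π ∣ d • f := by
      rw [← hf.sum_X_mul_pderiv]
      exact Finset.dvd_sum fun i _ => (hπ i).mul_left _
    have h2 : (C (d : ℂ)⁻¹ : S) * (d • f) = f := by
      rw [nsmul_eq_mul, ← mul_assoc, ← map_natCast (C : ℂ →+* S), ← C_mul,
        inv_mul_cancel₀ (by exact_mod_cast hd), C_1, one_mul]
    rw [← h2]
    exact h1.mul_left _
  obtain ⟨g, rfl⟩ := hπf
  by_cases hg : π ∣ g
  · exact hirr.not_isUnit (hred π (mul_dvd_mul_left π hg))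
  · have hder : ∀ i, pderiv i π = 0 := fun i => by
      have h1 := hπ i
      rw [pderiv_mul] at h1
      have h2 : π ∣ pderiv i π :=
        (hprime.dvd_or_dvd ((dvd_add_left (dvd_mul_right π _)).1 h1)).resolve_right hg
      by_contra h0
      have hlt := (pderiv_eq_zero_or_totalDegree_lt π i).resolve_left h0
      obtain ⟨c, hc⟩ := h2
      have hc0 : c ≠ 0 := fun h => h0 (by rw [hc, h, mul_zero])
      rw [hc, totalDegree_mul_of_isDomain hirr.ne_zero hc0] at hlt
      omega
    have h0 := eq_C_of_pderiv_eq_zero hder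
    have hc : coeff 0 π ≠ 0 := fun h => hirr.ne_zero (by rw [h0, h, C_0])
    apply hirr.not_isUnit
    rw [h0]
    exact (IsUnit.mk0 _ hc).map C

/-- A vector proportional to a primitive one is a multiple of it. -/
lemma exists_eq_mul_of_cross {R ι : Type*} [CommRing R] [IsDomain R]
    [UniqueFactorizationMonoid R] {φ m : ι → R}
    (hprim : ∀ π : R, Irreducible π → ∃ i, ¬ π ∣ φ i) {i₀ : ι} (hi₀ : φ i₀ ≠ 0)
    (hcross : ∀ i j, m i * φ j = m j * φ i) : ∃ h, ∀ i, m i = h * φ i := by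
  suffices hdvd : φ i₀ ∣ m i₀ by
    obtain ⟨h, hh⟩ := hdvd
    refine ⟨h, fun i => mul_right_cancel₀ hi₀ ?_⟩
    rw [hcross, hh]
    ring
  -- The primes of `x` are removed one at a time: each fails to divide some `φ j`, so it divides
  -- `y`.
  have key : ∀ x y : R, x ≠ 0 → (∀ j, x ∣ y * φ j) → x ∣ y := by
    intro x y hx
    induction x using UniqueFactorizationMonoid.induction_on_prime generalizing y with
    | h₁ => exact absurd rfl hx
    | h₂ x hu => exact fun _ => hu.dvd
    | h₃ a p ha hp ih =>
      intro hdiv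
      obtain ⟨j, hj⟩ := hprim p hp.irreducible
      have hpy : p ∣ y :=
        (hp.dvd_or_dvd ((dvd_mul_right p a).trans (hdiv j))).resolve_right hj
      obtain ⟨z, rfl⟩ := hpy
      refine mul_dvd_mul_left p (ih z ha fun k => ?_)
      have := hdiv k
      rw [mul_assoc] at this
      exact (mul_dvd_mul_iff_left hp.ne_zero).1 this
  refine key _ _ hi₀ fun j => ?_
  rw [hcross]
  exact dvd_mul_left _ _

/-! ### Wedge products and minors -/

/-- The signed maximal minors of three vectors in `S⁴`, linear in the last one. -/
def minors (a b : Fin 4 → S) : (Fin 4 → S) →ₗ[S] (Fin 4 → S) where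
  toFun c := ![
    a 1 * (b 2 * c 3 - b 3 * c 2) - a 2 * (b 1 * c 3 - b 3 * c 1) + a 3 * (b 1 * c 2 - b 2 * c 1),
    -(a 0 * (b 2 * c 3 - b 3 * c 2) - a 2 * (b 0 * c 3 - b 3 * c 0) +
      a 3 * (b 0 * c 2 - b 2 * c 0)),
    a 0 * (b 1 * c 3 - b 3 * c 1) - a 1 * (b 0 * c 3 - b 3 * c 0) + a 3 * (b 0 * c 1 - b 1 * c 0),
    -(a 0 * (b 1 * c 2 - b 2 * c 1) - a 1 * (b 0 * c 2 - b 2 * c 0) +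
      a 2 * (b 0 * c 1 - b 1 * c 0))]
  map_add' c c' := by
    funext i
    fin_cases i <;> simp <;> ring
  map_smul' r c := by
    funext i
    fin_cases i <;> simp <;> ring

lemma minors_self_left (a b : Fin 4 → S) : minors a b a = 0 := by
  funext i
  fin_cases i <;> simp [minors] <;> ring

lemma minors_self_right (a b : Fin 4 → S) : minors a b b = 0 := by
  funext i
  fin_cases i <;> simp [minors] <;> ring

lemma minors_smul_left (r : S) (a b c : Fin 4 → S) : minors (r • a) b c = r • minors a b c := by
  funext i
  fin_cases i <;> simp [minors] <;> ring

lemma minors_self (a c : Fin 4 → S) : minors a a c = 0 := by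
  funext i
  fin_cases i <;> simp [minors] <;> ring

lemma minors_add_left (a a' b c : Fin 4 → S) :
    minors (a + a') b c = minors a b c + minors a' b c := by
  funext i
  fin_cases i <;> simp [minors] <;> ring

lemma minors_swap (a b c : Fin 4 → S) : minors a b c = - minors b a c := by
  funext i
  fin_cases i <;> simp [minors] <;> ring

lemma isHomogeneous_minors {a b c : Fin 4 → S} {i j k : ℕ} (ha : IsHomogeneousVec a i)
    (hb : IsHomogeneousVec b j) (hc : IsHomogeneousVec c k) :
    IsHomogeneousVec (minors a b c) (i + j + k) := by
  have h2 : ∀ s t, (b s * c t - b t * c s).IsHomogeneous (j + k) := fun s t =>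
    ((hb s).mul (hc t)).sub ((hb t).mul (hc s))
  have h3 : ∀ r s t, (a r * (b s * c t - b t * c s)).IsHomogeneous (i + j + k) := fun r s t => by
    rw [add_assoc]
    exact (ha r).mul (h2 s t)
  intro n
  fin_cases n
  · exact ((h3 1 2 3).sub (h3 2 1 3)).add (h3 3 1 2)
  · exact (((h3 0 2 3).sub (h3 2 0 3)).add (h3 3 0 2)).neg
  · exact ((h3 0 1 3).sub (h3 1 0 3)).add (h3 3 0 1)
  · exact (((h3 0 1 2).sub (h3 1 0 2)).add (h3 2 0 1)).neg

/-- Maximal minors of three vectors orthogonal to `φ` are proportional to `φ`. -/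
lemma minors_cross {a b c φ : Fin 4 → S} (ha : ∑ i, a i * φ i = 0) (hb : ∑ i, b i * φ i = 0)
    (hc : ∑ i, c i * φ i = 0) (i j : Fin 4) :
    minors a b c i * φ j = minors a b c j * φ i := by
  have key : ∀ i j : Fin 4, i < j → minors a b c i * φ j = minors a b c j * φ i := by
    intro i j hij
    simp only [Fin.sum_univ_four] at ha hb hc
    fin_cases i <;> fin_cases j <;> simp at hij <;> simp [minors]
    -- Cramer's rule: the three orthogonality relations are combined with the 2×2 minors on the two
    -- columns other than `i`, `j`.
    · linear_combination ((b 2 * c 3 - b 3 * c 2) * ha - (a 2 * c 3 - a 3 * c 2) * hb +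
        (a 2 * b 3 - a 3 * b 2) * hc)
    · linear_combination -((b 1 * c 3 - b 3 * c 1) * ha - (a 1 * c 3 - a 3 * c 1) * hb +
        (a 1 * b 3 - a 3 * b 1) * hc)
    · linear_combination ((b 1 * c 2 - b 2 * c 1) * ha - (a 1 * c 2 - a 2 * c 1) * hb +
        (a 1 * b 2 - a 2 * b 1) * hc)
    · linear_combination ((b 0 * c 3 - b 3 * c 0) * ha - (a 0 * c 3 - a 3 * c 0) * hb +
        (a 0 * b 3 - a 3 * b 0) * hc)
    · linear_combination -((b 0 * c 2 - b 2 * c 0) * ha - (a 0 * c 2 - a 2 * c 0) * hb +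
        (a 0 * b 2 - a 2 * b 0) * hc)
    · linear_combination ((b 0 * c 1 - b 1 * c 0) * ha - (a 0 * c 1 - a 1 * c 0) * hb +
        (a 0 * b 1 - a 1 * b 0) * hc)
  rcases lt_trichotomy i j with h | rfl | h
  · exact key i j h
  · rfl
  · exact (key j i h).symm

/-- Up to sign, the minors are the coordinates of the 3-form in the products of the `dx_i`. This
implication turns `h ρ = 0` into the vanishing to which tameness applies. -/
lemma wedge_eq_zero_of_minors {a b c : Fin 4 → S} (h : minors a b c = 0) :
    ExteriorAlgebra.ι S a * ExteriorAlgebra.ι S b * ExteriorAlgebra.ι S c = 0 := by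
  let E : Fin 4 → ExteriorAlgebra S (Fin 4 → S) := fun i => ExteriorAlgebra.ι S (Pi.single i 1)
  have hexp : ∀ v : Fin 4 → S, ExteriorAlgebra.ι S v = v 0 • E 0 + v 1 • E 1 + v 2 • E 2 + v 3 • E 3 :=
    fun v => by
      conv_lhs => rw [pi_eq_sum_univ' v]
      simp [Fin.sum_univ_four, E]
  have hsq : ∀ i, E i * E i = 0 := fun i => ExteriorAlgebra.ι_sq_zero _
  have hsw : ∀ i j, E i * E j = - (E j * E i) := fun i j =>
    eq_neg_of_add_eq_zero_left (ExteriorAlgebra.ι_add_mul_swap _ _)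
  have hsq' : ∀ i x, E i * (E i * x) = 0 := fun i x => by rw [← mul_assoc, hsq, zero_mul]
  have hsw' : ∀ i j x, E i * (E j * x) = - (E j * (E i * x)) := fun i j x => by
    rw [← mul_assoc, hsw, neg_mul, mul_assoc]
  have expand : ExteriorAlgebra.ι S a * ExteriorAlgebra.ι S b * ExteriorAlgebra.ι S c =
      minors a b c 0 • (E 1 * (E 2 * E 3)) - minors a b c 1 • (E 0 * (E 2 * E 3)) +
      minors a b c 2 • (E 0 * (E 1 * E 3)) - minors a b c 3 • (E 0 * (E 1 * E 2)) := by
    rw [hexp a, hexp b, hexp c]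
    simp only [add_mul, mul_add, smul_mul_assoc, mul_smul_comm, mul_assoc, hsq, hsq',
      hsw 1 0, hsw 2 0, hsw 3 0, hsw 2 1, hsw 3 1, hsw 3 2, hsw' 1 0, hsw' 2 0,
      hsw' 2 1, smul_zero, mul_zero, zero_mul, mul_neg, neg_mul, neg_neg, smul_neg, neg_zero]
    simp [minors]
    module
  rw [expand, h]
  simp

/-! ### The contraction `AR(f) → S` attached to a pair of syzygies -/

lemma mem_AR {f : S} {ρ : Fin 4 → S} : ρ ∈ AR f ↔ ∑ i, ρ i * pderiv i f = 0 := Iff.rfl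

lemma exists_pderiv_ne_zero {f : S} {d : ℕ} (hf : f.IsHomogeneous d) (hd : d ≠ 0)
    (hred : Squarefree f) : ∃ i, pderiv i f ≠ 0 := by
  by_contra! h
  exact false_of_irreducible_dvd_pderiv hf hd hred (π := X 0) (fun i => by rw [h i]; exact dvd_zero _)
    X_prime.irreducible

/-- The module of Jacobian syzygies is not generated by two elements. -/
lemma exists_notMem_span_pair {f : S} {i₀ : Fin 4} (hi₀ : pderiv i₀ f ≠ 0) (ρ₁ ρ₂ : AR f) :
    ∃ ρ : AR f, ρ ∉ Submodule.span S {ρ₁, ρ₂} := by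
  by_contra! h
  -- The three Koszul syzygies `f_{i₀} e_j - f_j e_{i₀}`, `j ≠ i₀`. Their coordinates away from `i₀`
  -- form `f_{i₀}` times the identity matrix, so they are independent.
  let κ : {j : Fin 4 // j ≠ i₀} → AR f := fun j =>
    ⟨Pi.single j.1 (pderiv i₀ f) - Pi.single i₀ (pderiv j.1 f), by
      simp [mem_AR, sub_mul, Pi.single_apply]
      ring⟩
  have hκ : LinearIndependent S κ := by
    rw [Fintype.linearIndependent_iff]
    intro c hc j
    have h1 := congrFun (congrArg Subtype.val hc) j.1
    have h2 : ∀ j' : {j : Fin 4 // j ≠ i₀}, (κ j' : Fin 4 → S) j.1 =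
        if j' = j then pderiv i₀ f else 0 := fun j' => by
      simp [κ, Pi.single_apply, j.2, Subtype.ext_iff, eq_comm]
    simp only [Submodule.coe_sum, Submodule.coe_smul, Finset.sum_apply, Pi.smul_apply, h2,
      smul_eq_mul, mul_ite, mul_zero, Finset.sum_ite_eq', Finset.mem_univ, if_true] at h1
    simpa [hi₀] using h1
  have hcard := linearIndependent_le_span_finset κ hκ {ρ₁, ρ₂} (by
    rw [eq_top_iff]
    intro ρ _
    simpa using h ρ)
  have h2 : ({ρ₁, ρ₂} : Finset (AR f)).card ≤ 2 := Finset.card_le_two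
  rw [Cardinal.mk_fintype, Fintype.card_subtype_compl] at hcard
  have h3 := Nat.cast_le.1 hcard
  simp at h3
  omega

/-- The quotient of the minors by the gradient is a polynomial because the partial derivatives have
no common irreducible factor. Linearity follows by cancelling a nonzero partial derivative. -/
lemma exists_contraction {f : S} {d : ℕ} (hf : f.IsHomogeneous d) (hd : d ≠ 0)
    (hred : Squarefree f) (ρ₁ ρ₂ : AR f) :
    ∃ h : AR f →ₗ[S] S, ∀ (ρ : AR f) i, minors ρ₁ ρ₂ ρ i = h ρ * pderiv i f := by
  obtain ⟨i₀, hi₀⟩ := exists_pderiv_ne_zero hf hd hred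
  have hex : ∀ ρ : AR f, ∃ h, ∀ i, minors ρ₁ ρ₂ ρ i = h * pderiv i f := fun ρ =>
    exists_eq_mul_of_cross (fun π hπ => by
      by_contra! hall
      exact false_of_irreducible_dvd_pderiv hf hd hred hall hπ) hi₀
      (minors_cross (mem_AR.1 ρ₁.2) (mem_AR.1 ρ₂.2) (mem_AR.1 ρ.2))
  choose h hh using hex
  refine ⟨{ toFun := h, map_add' := fun a b => ?_, map_smul' := fun r a => ?_ }, hh⟩
  · apply mul_right_cancel₀ hi₀
    rw [← hh, add_mul, ← hh, ← hh, Submodule.coe_add, map_add, Pi.add_apply]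
  · apply mul_right_cancel₀ hi₀
    rw [← hh, Submodule.coe_smul, map_smul, Pi.smul_apply, hh, RingHom.id_apply, smul_eq_mul,
      smul_eq_mul, mul_assoc]

/-- A graded exact sequence `0 → S(-e₁) ⊕ S(-e₂) → AR(f) → S(-e₃)`. -/
structure IsContraction (f : S) (e₁ e₂ e₃ : ℕ) (ρ₁ ρ₂ : AR f) (h : AR f →ₗ[S] S) : Prop where
  homogeneous₁ : IsHomogeneousVec (ρ₁ : Fin 4 → S) e₁
  homogeneous₂ : IsHomogeneousVec (ρ₂ : Fin 4 → S) e₂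
  eq_zero_iff : ∀ ρ, h ρ = 0 ↔ ∃ a b : S, a • ρ₁ + b • ρ₂ = ρ
  independent : ∀ a b : S, a • ρ₁ + b • ρ₂ = 0 → a = 0 ∧ b = 0
  graded : ∀ (ρ : AR f) (k j : ℕ), IsHomogeneousVec (ρ : Fin 4 → S) k → j + e₃ ≠ k →
    homogeneousComponent j (h ρ) = 0

/-- Exactness identifies the kernel. A relation between `ρ₁` and `ρ₂` is multiplied into the minors
with a syzygy outside their span, where `h` is nonzero, so its coefficients vanish. The minors have
degree `e₁ + e₂ + k` and the partial derivatives `e₁ + e₂ + e₃`, hence the shift by `e₃`. -/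
lemma exists_contraction_of_exact {f : S} {d e₁ e₂ e₃ : ℕ} (hf : f.IsHomogeneous d)
    (hred : Squarefree f) (he : e₁ + e₂ + e₃ + 1 = d) {ρ₁ ρ₂ : AR f}
    (h₁ : IsHomogeneousVec (ρ₁ : Fin 4 → S) e₁) (h₂ : IsHomogeneousVec (ρ₂ : Fin 4 → S) e₂)
    (hex : Function.Exact (mapU ρ₁ ρ₂) (mapV ρ₁ ρ₂)) :
    ∃ h, IsContraction f e₁ e₂ e₃ ρ₁ ρ₂ h := by
  have hd : d ≠ 0 := by omega
  obtain ⟨h, hh⟩ := exists_contraction hf hd hred ρ₁ ρ₂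
  obtain ⟨i₀, hi₀⟩ := exists_pderiv_ne_zero hf hd hred
  have hρ₁ : h ρ₁ = 0 := mul_right_cancel₀ hi₀ (by rw [← hh, minors_self_left]; simp)
  have hρ₂ : h ρ₂ = 0 := mul_right_cancel₀ hi₀ (by rw [← hh, minors_self_right]; simp)
  have hker : ∀ ρ, h ρ = 0 ↔ ∃ a b : S, a • ρ₁ + b • ρ₂ = ρ := by
    intro ρ
    constructor
    · intro h0
      have hV : mapV ρ₁ ρ₂ ρ = 0 := wedge_eq_zero_of_minors (by
        funext i
        exact (hh ρ i).trans (by rw [h0, zero_mul, Pi.zero_apply]))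
      obtain ⟨⟨a, b⟩, hab⟩ := (hex ρ).1 hV
      exact ⟨a, b, hab⟩
    · rintro ⟨a, b, rfl⟩
      simp [hρ₁, hρ₂]
  obtain ⟨ρ, hρ⟩ := exists_notMem_span_pair hi₀ ρ₁ ρ₂
  have hρ0 : h ρ ≠ 0 := fun h0 => hρ (Submodule.mem_span_pair.2 ((hker ρ).1 h0))
  have hne : minors ρ₁ ρ₂ ρ i₀ ≠ 0 := by
    rw [hh]
    exact mul_ne_zero hρ0 hi₀
  refine ⟨h, h₁, h₂, hker, fun a b hab => ?_, fun ρ k j hρ hj => ?_⟩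
  · have hab' : a • (ρ₁ : Fin 4 → S) + b • (ρ₂ : Fin 4 → S) = 0 := congrArg Subtype.val hab
    have hz : ∀ v : Fin 4 → S, minors 0 v ρ = 0 := fun v => by
      have := minors_smul_left 0 0 v ρ
      rwa [zero_smul, zero_smul] at this
    constructor
    · have h1 : a • minors ρ₁ ρ₂ ρ = 0 := by
        rw [← hz ρ₂, ← hab', minors_add_left, minors_smul_left, minors_smul_left,
          minors_self, smul_zero, add_zero]
      exact (mul_eq_zero.1 (congrFun h1 i₀)).resolve_right hne
    · have h1 : b • minors ρ₁ ρ₂ ρ = 0 := by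
        rw [minors_swap, smul_neg, neg_eq_zero, ← hz ρ₁, ← hab', minors_add_left,
          minors_smul_left, minors_smul_left, minors_self, smul_zero, zero_add]
      exact (mul_eq_zero.1 (congrFun h1 i₀)).resolve_right hne
  · refine homogeneousComponent_cofactor (hf.pderiv (i := i₀)) hi₀ (n := e₁ + e₂ + k) ?_ ?_
    · rw [mul_comm, ← hh]
      exact isHomogeneous_minors h₁ h₂ hρ i₀
    · omega

/-! ### Dimensions of the graded pieces of `AR(f)` -/

/-- The homogeneous Jacobian syzygies of degree `k`. -/
def arComponent (f : S) (k : ℕ) : Submodule ℂ (AR f) where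
  carrier := {ρ | IsHomogeneousVec (ρ : Fin 4 → S) k}
  zero_mem' _ := isHomogeneous_zero _ _ _
  add_mem' ha hb i := (ha i).add (hb i)
  smul_mem' c _ hρ i := (homogeneousSubmodule (Fin 4) ℂ k).smul_mem c (hρ i)

lemma mem_arComponent {f : S} {k : ℕ} {ρ : AR f} :
    ρ ∈ arComponent f k ↔ IsHomogeneousVec (ρ : Fin 4 → S) k := Iff.rfl

/-- The vectors with all coordinates homogeneous of degree `k`. -/
def vecComponent (k : ℕ) : Submodule ℂ (Fin 4 → S) :=
  Submodule.pi Set.univ fun _ => homogeneousSubmodule (Fin 4) ℂ k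

lemma mem_vecComponent {k : ℕ} {ρ : Fin 4 → S} : ρ ∈ vecComponent k ↔ IsHomogeneousVec ρ k := by
  simp [vecComponent, IsHomogeneousVec]

/-- Vectors of forms are families of forms. -/
def vecComponentEquiv (k : ℕ) :
    vecComponent k ≃ₗ[ℂ] (Fin 4 → homogeneousSubmodule (Fin 4) ℂ k) where
  toFun ρ i := ⟨ρ.1 i, mem_vecComponent.1 ρ.2 i⟩
  invFun g := ⟨fun i => g i, mem_vecComponent.2 fun i => (g i).2⟩
  map_add' _ _ := rfl
  map_smul' _ _ := rfl

instance (k : ℕ) : FiniteDimensional ℂ (vecComponent k) :=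
  Module.Finite.equiv (vecComponentEquiv k).symm

lemma finrank_vecComponent (k : ℕ) :
    Module.finrank ℂ (vecComponent k) = 4 * (k + 3).choose 3 := by
  rw [(vecComponentEquiv k).finrank_eq, Module.finrank_pi_fintype]
  simp [finrank_homogeneousSubmodule]

/-- Inclusion of the syzygies in `S⁴`, over `ℂ`. -/
def arSubtype (f : S) : AR f →ₗ[ℂ] (Fin 4 → S) := (AR f).subtype.restrictScalars ℂ

lemma arSubtype_injective (f : S) : Function.Injective (arSubtype f) := Subtype.val_injective

lemma map_arComponent_le (f : S) (k : ℕ) : (arComponent f k).map (arSubtype f) ≤ vecComponent k := by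
  rintro _ ⟨ρ, hρ, rfl⟩
  exact mem_vecComponent.2 hρ

instance (f : S) (k : ℕ) : FiniteDimensional ℂ (arComponent f k) := by
  have := Submodule.finiteDimensional_of_le (map_arComponent_le f k)
  exact Module.Finite.equiv (Submodule.equivMapOfInjective _ (arSubtype_injective f) _).symm

/-- `0 → AR(f)_k → (S_k)⁴ → (J_f)_{k + d - 1} → 0`. -/
lemma finrank_arComponent_add {f : S} {D : ℕ} (hf : f.IsHomogeneous (D + 1)) (k : ℕ) :
    Module.finrank ℂ (arComponent f k) +
      Module.finrank ℂ (idealComponent (jacobianIdeal f) (D + k)) = 4 * (k + 3).choose 3 := by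
  have hpd : ∀ i, (pderiv i f).IsHomogeneous D := fun i => hf.pderiv
  let φ : (Fin 4 → S) →ₗ[ℂ] S :=
    ∑ i, (LinearMap.mulLeft ℂ (pderiv i f)) ∘ₗ (LinearMap.proj i)
  have hφ : ∀ ρ, φ ρ = ∑ i, pderiv i f * ρ i := fun ρ => by simp [φ]
  have h1 := finrank_map_add_finrank_inf_ker (vecComponent k) φ
  have h2 : (vecComponent k).map φ = idealComponent (jacobianIdeal f) (D + k) := by
    ext g
    constructor
    · rintro ⟨ρ, hρ, rfl⟩
      rw [hφ]
      refine ⟨IsHomogeneous.sum _ _ _ fun i _ => (hpd i).mul (mem_vecComponent.1 hρ i), ?_⟩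
      exact Ideal.sum_mem _ fun i _ =>
        Ideal.mul_mem_right _ _ (Ideal.subset_span (Set.mem_range_self i))
    · rintro ⟨hg, hgJ⟩
      obtain ⟨c, hc⟩ := (Ideal.mem_span_range_iff_exists_fun).1 hgJ
      refine ⟨fun i => homogeneousComponent k (c i), mem_vecComponent.2 fun i =>
        homogeneousComponent_isHomogeneous _ _, ?_⟩
      rw [hφ, ← homogeneousComponent_eq_self hg, ← hc, map_sum]
      refine Finset.sum_congr rfl fun i _ => ?_
      rw [mul_comm (c i), homogeneousComponent_add_mul (hpd i)]
  have h3 : vecComponent k ⊓ LinearMap.ker φ = (arComponent f k).map (arSubtype f) := by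
    ext ρ
    constructor
    · rintro ⟨hρ, hρ0⟩
      refine ⟨⟨ρ, ?_⟩, mem_vecComponent.1 hρ, rfl⟩
      rw [mem_AR]
      refine Eq.trans ?_ ((hφ ρ).symm.trans hρ0)
      exact Finset.sum_congr rfl fun i _ => mul_comm _ _
    · rintro ⟨σ, hσ, rfl⟩
      refine ⟨mem_vecComponent.2 hσ, ?_⟩
      change φ _ = 0
      rw [hφ]
      refine Eq.trans ?_ (mem_AR.1 σ.2)
      exact Finset.sum_congr rfl fun i _ => mul_comm _ _
  rw [h2, h3, ← LinearEquiv.finrank_eq (Submodule.equivMapOfInjective _ (arSubtype_injective f) _),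
    finrank_vecComponent] at h1
  omega

/-- The graded pieces of the span of independent homogeneous syzygies. -/
lemma finrank_arComponent_inf_span {f : S} {m : ℕ} {b : Fin m → AR f} {n : Fin m → ℕ}
    (hb : LinearIndependent S b) (hn : ∀ i, IsHomogeneousVec (b i : Fin 4 → S) (n i)) {k : ℕ}
    (hk : ∀ i, n i ≤ k) :
    Module.finrank ℂ (arComponent f k ⊓ (Submodule.span S (Set.range b)).restrictScalars ℂ :
      Submodule ℂ (AR f)) = ∑ i, (k - n i + 3).choose 3 := by
  let Ψ : ((i : Fin m) → homogeneousSubmodule (Fin 4) ℂ (k - n i)) →ₗ[ℂ] AR f :=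
    { toFun := fun c => ∑ i, (c i : S) • b i
      map_add' := fun c c' => by simp [add_smul, Finset.sum_add_distrib]
      map_smul' := fun r c => by simp [Finset.smul_sum, smul_assoc] }
  have hΨ : Function.Injective Ψ := by
    rw [injective_iff_map_eq_zero]
    intro c hc
    funext i
    exact Subtype.ext (Fintype.linearIndependent_iff.1 hb (fun i => (c i : S)) hc i)
  have hrange : arComponent f k ⊓ (Submodule.span S (Set.range b)).restrictScalars ℂ =
      LinearMap.range Ψ := by
    ext ρ
    constructor
    · rintro ⟨hρ, hρb⟩
      obtain ⟨c, rfl⟩ := (Submodule.mem_span_range_iff_exists_fun S).1 hρb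
      refine ⟨fun i => ⟨homogeneousComponent (k - n i) (c i),
        homogeneousComponent_isHomogeneous _ _⟩, Subtype.ext (funext fun j => ?_)⟩
      have h1 := homogeneousComponent_eq_self (mem_arComponent.1 hρ j)
      rw [← h1]
      simp only [Ψ, LinearMap.coe_mk, AddHom.coe_mk, Submodule.coe_sum, Submodule.coe_smul,
        Finset.sum_apply, Pi.smul_apply, smul_eq_mul, map_sum]
      refine Finset.sum_congr rfl fun i _ => ?_
      rw [mul_comm (c i), homogeneousComponent_homogeneous_mul (hn i j), if_pos (hk i), mul_comm]
    · rintro ⟨c, rfl⟩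
      refine ⟨fun j => ?_, show ∑ i, (c i : S) • b i ∈ Submodule.span S (Set.range b) from
        Submodule.sum_mem _ fun i _ =>
          Submodule.smul_mem _ _ (Submodule.subset_span (Set.mem_range_self i))⟩
      simp only [Ψ, LinearMap.coe_mk, AddHom.coe_mk, Submodule.coe_sum, Submodule.coe_smul,
        Finset.sum_apply, Pi.smul_apply, smul_eq_mul]
      refine IsHomogeneous.sum _ _ _ fun i _ => ?_
      have h1 := IsHomogeneous.mul (c i).2 (hn i j)
      rwa [Nat.sub_add_cancel (hk i)] at h1
  rw [hrange, LinearMap.finrank_range_of_inj hΨ, Module.finrank_pi_fintype]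
  simp_rw [finrank_homogeneousSubmodule]

/-- The forms `h ρ`, with `ρ` homogeneous of degree `k`. -/
def contractionComponent {f : S} (h : AR f →ₗ[S] S) (k : ℕ) : Submodule ℂ S :=
  (arComponent f k).map (h.restrictScalars ℂ)

instance {f : S} (h : AR f →ₗ[S] S) (k : ℕ) : FiniteDimensional ℂ (contractionComponent h k) :=
  inferInstanceAs (FiniteDimensional ℂ ((arComponent f k).map (h.restrictScalars ℂ)))

variable {f : S} {e₁ e₂ e₃ : ℕ} {ρ₁ ρ₂ : AR f} {h : AR f →ₗ[S] S}

lemma IsContraction.linearIndependent (hc : IsContraction f e₁ e₂ e₃ ρ₁ ρ₂ h) :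
    LinearIndependent S ![ρ₁, ρ₂] :=
  LinearIndependent.pair_iff.2 hc.independent

lemma IsContraction.le_homogeneousSubmodule (hc : IsContraction f e₁ e₂ e₃ ρ₁ ρ₂ h) (k : ℕ) :
    contractionComponent h (k + e₃) ≤ homogeneousSubmodule (Fin 4) ℂ k := by
  rintro _ ⟨ρ, hρ, rfl⟩
  exact isHomogeneous_of_component fun j hj => hc.graded ρ (k + e₃) j hρ (by omega)

/-- Rank-nullity for `h` in degree `k`, with kernel free on `ρ₁, ρ₂`. The bounds on `k` matter: for
`k < e₁` truncated subtraction would count `1` instead of `0`. -/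
lemma IsContraction.finrank_arComponent (hc : IsContraction f e₁ e₂ e₃ ρ₁ ρ₂ h) {k : ℕ}
    (h₁ : e₁ ≤ k) (h₂ : e₂ ≤ k) :
    Module.finrank ℂ (arComponent f k) = Module.finrank ℂ (contractionComponent h k) +
      ((k - e₁ + 3).choose 3 + (k - e₂ + 3).choose 3) := by
  have hfam := finrank_arComponent_inf_span (b := ![ρ₁, ρ₂]) (n := ![e₁, e₂]) (k := k)
    hc.linearIndependent
    (by intro i; fin_cases i; exacts [hc.homogeneous₁, hc.homogeneous₂])
    (by intro i; fin_cases i; exacts [h₁, h₂])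
  rw [Fin.sum_univ_two] at hfam
  rw [← finrank_map_add_finrank_inf_ker _ (h.restrictScalars ℂ), contractionComponent]
  congr 1
  refine Eq.trans ?_ hfam
  suffices LinearMap.ker (h.restrictScalars ℂ) =
      (Submodule.span S (Set.range ![ρ₁, ρ₂])).restrictScalars ℂ by rw [this]
  ext ρ
  simp only [LinearMap.mem_ker, LinearMap.restrictScalars_apply, hc.eq_zero_iff,
    Submodule.restrictScalars_mem, Matrix.range_cons, Matrix.range_empty, Set.union_empty,
    Set.singleton_union, Submodule.mem_span_pair]

/-- The Hilbert function of the Milnor algebra in terms of the image of `h`. -/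
lemma IsContraction.hilbertFunction_add (hc : IsContraction f e₁ e₂ e₃ ρ₁ ρ₂ h)
    {D : ℕ} (hf : f.IsHomogeneous (D + 1)) {k : ℕ} (h₁ : e₁ ≤ k) (h₂ : e₂ ≤ k) :
    hilbertFunction (jacobianIdeal f) (D + k) + 4 * (k + 3).choose 3 =
      (D + k + 3).choose 3 + (Module.finrank ℂ (contractionComponent h k) +
      ((k - e₁ + 3).choose 3 + (k - e₂ + 3).choose 3)) := by
  have h3 := FreeSurface.hilbertFunction_add (jacobianIdeal f) (D + k)
  have h4 := finrank_arComponent_add hf k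
  have h5 := hc.finrank_arComponent h₁ h₂
  omega

lemma isHomogeneousIdeal_jacobianIdeal {f : S} {d : ℕ} (hf : f.IsHomogeneous d) :
    IsHomogeneousIdeal (jacobianIdeal f) := fun g hg n => by
  obtain ⟨c, rfl⟩ := (Ideal.mem_span_range_iff_exists_fun).1 hg
  rw [map_sum]
  refine Ideal.sum_mem _ fun i _ => ?_
  rw [mul_comm, homogeneousComponent_homogeneous_mul (hf.pderiv (i := i))]
  split_ifs
  · exact Ideal.mul_mem_right _ _ (Ideal.subset_span (Set.mem_range_self i))
  · exact zero_mem _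

/-! ### Binary forms -/

/-- The homogenization `∑ pᵢ uⁱ v^(k-i)` of a univariate polynomial. -/
def binaryForm (u v : S) (k : ℕ) : Polynomial ℂ →ₗ[ℂ] S where
  toFun p := ∑ i ∈ Finset.range (k + 1), C (p.coeff i) * (u ^ i * v ^ (k - i))
  map_add' p q := by simp [add_mul, Finset.sum_add_distrib]
  map_smul' c p := by simp [Finset.mul_sum, mul_assoc, smul_eq_C_mul]

lemma binaryForm_apply (u v : S) (k : ℕ) (p : Polynomial ℂ) :
    binaryForm u v k p = ∑ i ∈ Finset.range (k + 1), C (p.coeff i) * (u ^ i * v ^ (k - i)) := rfl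

lemma binaryForm_X_mul (u v : S) (k : ℕ) (p : Polynomial ℂ) :
    binaryForm u v (k + 1) (Polynomial.X * p) = u * binaryForm u v k p := by
  rw [binaryForm_apply, Finset.sum_range_succ', binaryForm_apply, Finset.mul_sum]
  simp only [Polynomial.coeff_X_mul, Polynomial.coeff_X_mul_zero, map_zero, zero_mul, add_zero]
  refine Finset.sum_congr rfl fun i _ => ?_
  rw [Nat.add_sub_add_right]
  ring

lemma binaryForm_succ (u v : S) {k : ℕ} {p : Polynomial ℂ} (hp : p.natDegree ≤ k) :
    binaryForm u v (k + 1) p = v * binaryForm u v k p := by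
  rw [binaryForm_apply, Finset.sum_range_succ,
    Polynomial.coeff_eq_zero_of_natDegree_lt (by omega : p.natDegree < k + 1), binaryForm_apply,
    Finset.mul_sum]
  simp only [map_zero, zero_mul, add_zero]
  refine Finset.sum_congr rfl fun i hi => ?_
  rw [Finset.mem_range] at hi
  rw [show k + 1 - i = k - i + 1 by omega]
  ring

/-- Linear forms in `u`, `v`, up to scalars. -/
def linearForms (u v : S) : Set S := {g | (∃ r : ℂ, g = u - C r * v) ∨ g = v}

/-- Nonzero constants and linear forms in `u`, `v`. -/
def linearFactors (u v : S) : Set S := {g | IsUnit g} ∪ linearForms u v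

/-- Binary forms split. -/
lemma binaryForm_mem_closure (u v : S) {k : ℕ} {p : Polynomial ℂ} (hp0 : p ≠ 0)
    (hp : p.natDegree ≤ k) : binaryForm u v k p ∈ Submonoid.closure (linearFactors u v) := by
  induction k generalizing p with
  | zero =>
    rw [binaryForm_apply]
    refine Submonoid.subset_closure (Or.inl ?_)
    rw [Polynomial.eq_C_of_natDegree_le_zero hp] at hp0 ⊢
    simp only [zero_add, Finset.range_one, Finset.sum_singleton, Polynomial.coeff_C_zero, pow_zero,
      Nat.sub_zero, mul_one]
    exact (IsUnit.mk0 _ (by simpa using hp0)).map C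
  | succ k ih =>
    -- A drop in degree is a root at infinity, that is, a factor `v`; otherwise `p` has a root `r`
    -- and `u - r v` splits off.
    by_cases h0 : p.natDegree ≤ k
    · rw [binaryForm_succ u v h0]
      exact mul_mem (Submonoid.subset_closure (Or.inr (Or.inr rfl))) (ih hp0 h0)
    · obtain ⟨r, hr⟩ := IsAlgClosed.exists_root p (by
        intro h
        have : p.natDegree = 0 := Polynomial.natDegree_eq_of_degree_eq_some h
        omega)
      obtain ⟨q, rfl⟩ := Polynomial.dvd_iff_isRoot.2 hr
      have hq0 : q ≠ 0 := right_ne_zero_of_mul hp0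
      have hq : q.natDegree ≤ k := by
        rw [Polynomial.natDegree_mul (Polynomial.X_sub_C_ne_zero r) hq0,
          Polynomial.natDegree_X_sub_C] at hp
        omega
      have h1 : binaryForm u v (k + 1) ((Polynomial.X - Polynomial.C r) * q) =
          (u - C r * v) * binaryForm u v k q := by
        rw [sub_mul, map_sub, binaryForm_X_mul, ← Polynomial.smul_eq_C_mul, map_smul,
          binaryForm_succ u v hq, smul_eq_C_mul]
        ring
      rw [h1]
      exact mul_mem (Submonoid.subset_closure (Or.inr (Or.inl ⟨r, rfl⟩))) (ih hq0 hq)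

lemma binaryForm_ne_zero {i j : Fin 4} (hij : i ≠ j) {k : ℕ} {p : Polynomial ℂ} (hp0 : p ≠ 0)
    (hp : p.natDegree ≤ k) : binaryForm (X i) (X j) k p ≠ 0 := by
  intro h
  apply hp0
  -- Dehomogenizing, with `x_i` sent to the variable and the rest to `1`, recovers `p`.
  have h1 := congrArg (aeval (fun l => if l = i then (Polynomial.X : Polynomial ℂ) else 1)) h
  rw [binaryForm_apply, map_sum, map_zero] at h1
  simp only [map_mul, map_pow, aeval_X, if_true, if_neg hij.symm, one_pow, mul_one, aeval_C] at h1
  rw [p.as_sum_range' (k + 1) (by omega), ← h1]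
  exact Finset.sum_congr rfl fun l _ => by
    rw [Polynomial.algebraMap_eq, Polynomial.C_mul_X_pow_eq_monomial]

lemma isHomogeneous_binaryForm (i j : Fin 4) (k : ℕ) (p : Polynomial ℂ) :
    (binaryForm (X i) (X j) k p).IsHomogeneous k := by
  rw [binaryForm_apply]
  refine IsHomogeneous.sum _ _ _ fun l hl => ?_
  rw [Finset.mem_range] at hl
  have h1 := ((isHomogeneous_X_pow (R := ℂ) i l).mul (isHomogeneous_X_pow (R := ℂ) j (k - l)))
  rw [show l + (k - l) = k by omega] at h1
  exact h1.C_mul _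

/-- A space of forms of small codimension contains binary forms. -/
lemma exists_binaryForm_mem {i j : Fin 4} (hij : i ≠ j) {k : ℕ} {T : Submodule ℂ S}
    (hT : T ≤ homogeneousSubmodule (Fin 4) ℂ k)
    (hcodim : (k + 3).choose 3 ≤ Module.finrank ℂ T + k) :
    ∃ p : Polynomial ℂ, p ≠ 0 ∧ p.natDegree ≤ k ∧ binaryForm (X i) (X j) k p ∈ T := by
  have hTfin : FiniteDimensional ℂ T := Submodule.finiteDimensional_of_le hT
  let φ : Polynomial.degreeLT ℂ (k + 1) →ₗ[ℂ] S :=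
    (binaryForm (X i) (X j) k) ∘ₗ (Polynomial.degreeLT ℂ (k + 1)).subtype
  have hdeg : ∀ p : Polynomial.degreeLT ℂ (k + 1), p.1 ≠ 0 → p.1.natDegree ≤ k := fun p hp => by
    have := (Polynomial.natDegree_lt_iff_degree_lt hp).2 (Polynomial.mem_degreeLT.1 p.2)
    omega
  have hφ : Function.Injective φ := by
    rw [injective_iff_map_eq_zero]
    intro p hp
    by_contra hne
    have hne' : p.1 ≠ 0 := fun h => hne (Subtype.ext h)
    exact binaryForm_ne_zero hij hne' (hdeg p hne') hp
  have hfin : FiniteDimensional ℂ (Polynomial.degreeLT ℂ (k + 1)) :=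
    Module.Finite.equiv (Polynomial.degreeLTEquiv ℂ (k + 1)).symm
  have hrank : Module.finrank ℂ (LinearMap.range φ) = k + 1 := by
    rw [LinearMap.finrank_range_of_inj hφ, (Polynomial.degreeLTEquiv ℂ (k + 1)).finrank_eq]
    simp
  have hrange : LinearMap.range φ ≤ homogeneousSubmodule (Fin 4) ℂ k := by
    rintro _ ⟨p, rfl⟩
    exact isHomogeneous_binaryForm i j k p.1
  have h1 := Submodule.finrank_sup_add_finrank_inf_eq (LinearMap.range φ) T
  have h2 := Submodule.finrank_mono (sup_le hrange hT)
  rw [finrank_homogeneousSubmodule] at h2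
  -- Binary forms of degree `k` have dimension `k + 1`, while `T` has codimension at most `k`.
  have h3 : (LinearMap.range φ ⊓ T : Submodule ℂ S) ≠ ⊥ := by
    intro h
    rw [h, finrank_bot] at h1
    omega
  obtain ⟨_, ⟨⟨p, rfl⟩, hpT⟩, hp0⟩ := Submodule.exists_mem_ne_zero_of_ne_bot h3
  have hne : p.1 ≠ 0 := fun h => hp0 (by rw [show p = 0 from Subtype.ext h, map_zero])
  exact ⟨p.1, hne, hdeg p hne, hpT⟩

/-! ### Colon ideals of complete intersections of binary forms -/

/-- `(a, b) : K = (a, b)`. -/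
def ColonTrivial (K : Ideal S) (a b : S) : Prop :=
  ∀ u, (∀ c ∈ K, c * u ∈ Ideal.span {a, b}) → u ∈ Ideal.span {a, b}

lemma ColonTrivial.symm {K : Ideal S} {a b : S} (h : ColonTrivial K a b) : ColonTrivial K b a := by
  rw [ColonTrivial, Set.pair_comm]
  exact h

lemma ColonTrivial.of_isUnit (K : Ideal S) {a : S} (ha : IsUnit a) (b : S) : ColonTrivial K a b :=
  fun u _ => by
    rw [Ideal.eq_top_of_isUnit_mem _ (Ideal.subset_span (Set.mem_insert a {b})) ha]
    trivial

/-- As `x` is a nonzerodivisor modulo `b`, the quotient `(x, b) / (xy, b)` is a copy of `S / (y,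
b)`. An element killed by `K` modulo `(xy, b)` first lies in `(x, b)`, and then its coefficient at
`x` lies in `(y, b)`. -/
lemma ColonTrivial.mul {K : Ideal S} {x y b : S} (hxb : IsRelPrime x b) (hx : ColonTrivial K x b)
    (hy : ColonTrivial K y b) : ColonTrivial K (x * y) b := by
  intro u hu
  simp only [ColonTrivial, Ideal.mem_span_pair] at hx hy hu ⊢
  obtain ⟨v, w, rfl⟩ := hx u fun c hc => by
    obtain ⟨s, t, hst⟩ := hu c hc
    exact ⟨s * y, t, by rw [← hst]; ring⟩
  obtain ⟨v', w', rfl⟩ := hy v fun c hc => by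
    obtain ⟨s, t, hst⟩ := hu c hc
    have h1 : b ∣ x * (c * v - s * y) := ⟨t - c * w, by linear_combination -hst⟩
    obtain ⟨z, hz⟩ := hxb.symm.dvd_of_dvd_mul_left h1
    exact ⟨s, z, by linear_combination -hz⟩
  exact ⟨v', w' * x + w, by ring⟩

lemma sub_aeval_mem {I : Ideal S} {w : Fin 4 → S} (hw : ∀ k, X k - w k ∈ I) (g : S) :
    g - aeval w g ∈ I := by
  have h1 : (Ideal.Quotient.mkₐ ℂ I).comp (aeval w) = Ideal.Quotient.mkₐ ℂ I := by
    refine MvPolynomial.algHom_ext fun k => ?_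
    simp only [AlgHom.comp_apply, aeval_X]
    exact (Ideal.Quotient.eq.2 (hw k)).symm
  exact Ideal.Quotient.eq.1 (congrArg (fun F : S →ₐ[ℂ] S ⧸ I => F g) h1).symm

/-- A linear form in `x_i`, `x_j` is the kernel of a retraction of the polynomial ring. -/
lemma exists_retraction {i j : Fin 4} (hij : i ≠ j) {l : S} (hl : l ∈ linearForms (X i) (X j)) :
    ∃ φ : S →ₐ[ℂ] S, φ l = 0 ∧ (∀ g, g - φ g ∈ Ideal.span {l}) ∧
      (∀ k, k ≠ i → k ≠ j → φ (X k) = X k) ∧ ∃ t, (t = i ∨ t = j) ∧ φ (X t) = X t := by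
  rcases hl with ⟨r, rfl⟩ | rfl
  · refine ⟨aeval (Function.update X i (C r * X j)), ?_, sub_aeval_mem fun k => ?_,
      fun k hk _ => ?_, j, Or.inr rfl, ?_⟩
    · simp [Function.update_of_ne hij.symm, algebraMap_eq]
    · by_cases hk : k = i
      · subst hk
        rw [Function.update_self]
        exact Ideal.mem_span_singleton_self _
      · simp [Function.update_of_ne hk]
    · simp [Function.update_of_ne hk]
    · simp [Function.update_of_ne hij.symm]
  · refine ⟨aeval (Function.update X j 0), ?_, sub_aeval_mem fun k => ?_,
      fun k _ hk => ?_, i, Or.inl rfl, ?_⟩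
    · simp
    · by_cases hk : k = j
      · subst hk
        rw [Function.update_self, sub_zero]
        exact Ideal.mem_span_singleton_self _
      · simp [Function.update_of_ne hk]
    · simp [Function.update_of_ne hk]
    · simp [Function.update_of_ne hij]

lemma map_linearForm {i j : Fin 4} {l : S} (hl : l ∈ linearForms (X i) (X j)) (φ : S →ₐ[ℂ] S)
    (hi : φ (X i) = X i) (hj : φ (X j) = X j) : φ l = l := by
  rcases hl with ⟨r, rfl⟩ | rfl
  · rw [map_sub, map_mul, hi, hj, ← algebraMap_eq, AlgHom.commutes]
  · exact hj

lemma map_binaryForm (u v : S) (k : ℕ) (p : Polynomial ℂ) (φ : S →ₐ[ℂ] S)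
    (hu : φ u = u) (hv : φ v = v) : φ (binaryForm u v k p) = binaryForm u v k p := by
  rw [binaryForm_apply, map_sum]
  refine Finset.sum_congr rfl fun i _ => ?_
  rw [map_mul, map_mul, map_pow, map_pow, hu, hv, ← algebraMap_eq, AlgHom.commutes]

lemma linearForm_ne_zero {i j : Fin 4} (hij : i ≠ j) {l : S}
    (hl : l ∈ linearForms (X i) (X j)) : l ≠ 0 := by
  rintro rfl
  rcases hl with ⟨r, hr⟩ | hr
  · have := congrArg (aeval (fun l => if l = i then (1 : ℂ) else 0)) hr
    simp [hij.symm] at this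
  · exact X_ne_zero j hr.symm

lemma prime_linearForm {i j : Fin 4} (hij : i ≠ j) {l : S}
    (hl : l ∈ linearForms (X i) (X j)) : Prime l := by
  obtain ⟨φ, hφl, hφ, -⟩ := exists_retraction hij hl
  have hdvd : ∀ g, φ g = 0 → l ∣ g := fun g hg => by
    simpa [hg, Ideal.mem_span_singleton] using hφ g
  refine ⟨linearForm_ne_zero hij hl, fun hu => ?_, fun a b hab => ?_⟩
  · have := hu.map φ
    rw [hφl] at this
    exact not_isUnit_zero this
  · obtain ⟨c, hc⟩ := hab
    have h1 : φ a * φ b = 0 := by rw [← map_mul, hc, map_mul, hφl, zero_mul]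
    exact (mul_eq_zero.1 h1).imp (hdvd a) (hdvd b)

/-- Ideals containing binary forms in any two variables. -/
def HasBinaryForms (K : Ideal S) : Prop :=
  ∀ i j : Fin 4, i ≠ j → ∃ (k : ℕ) (p : Polynomial ℂ), p ≠ 0 ∧ p.natDegree ≤ k ∧
    binaryForm (X i) (X j) k p ∈ K

/-- The composite `ψ ∘ φ` embeds `S / (l, m)` in the domain `S` and fixes one variable `x_s` from
the first pair and one, `x_t`, from the second. A binary form of `K` in these two is therefore a
nonzerodivisor modulo `(l, m)`. -/
lemma isRelPrime_and_colonTrivial_linear {K : Ideal S} (hK : HasBinaryForms K) {l m : S}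
    (hl : l ∈ linearForms (X 0) (X 1)) (hm : m ∈ linearForms (X 2) (X 3)) :
    IsRelPrime l m ∧ ColonTrivial K l m := by
  obtain ⟨φ, hφl, hφ, hφX, s, hs, hφs⟩ := exists_retraction (by decide) hl
  obtain ⟨ψ, hψm, hψ, hψX, t, ht, hψt⟩ := exists_retraction (by decide) hm
  have hφm : φ m = m := map_linearForm hm φ (hφX 2 (by decide) (by decide))
    (hφX 3 (by decide) (by decide))
  have hprime := prime_linearForm (by decide) hl
  constructor
  · refine (hprime.irreducible.isRelPrime_iff_not_dvd).2 ?_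
    rintro ⟨c, hc⟩
    apply linearForm_ne_zero (by decide) hm
    rw [← hφm, hc, map_mul, hφl, zero_mul]
  · have hker : ∀ g, ψ (φ g) = 0 ↔ g ∈ Ideal.span {l, m} := fun g => by
      constructor
      · intro hg
        have h1 : g - φ g ∈ Ideal.span {l, m} := Ideal.span_mono (by simp) (hφ g)
        have h2 : φ g - ψ (φ g) ∈ Ideal.span {l, m} := Ideal.span_mono (by simp) (hψ (φ g))
        simpa [hg] using add_mem h1 h2
      · intro hg
        obtain ⟨a, b, rfl⟩ := Ideal.mem_span_pair.1 hg
        simp [hφl, hφm, hψm]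
    have hst : s ≠ t := by
      rcases hs with rfl | rfl <;> rcases ht with rfl | rfl <;> decide
    obtain ⟨k, p, hp0, hp, hpK⟩ := hK s t hst
    intro u hu
    rw [← hker]
    have h1 := (hker _).2 (hu _ hpK)
    rw [map_mul, map_mul, map_binaryForm _ _ _ _ φ hφs, map_binaryForm _ _ _ _ ψ _ hψt] at h1
    · exact (mul_eq_zero.1 h1).resolve_left (binaryForm_ne_zero hst hp0 hp)
    · rcases hs with rfl | rfl <;> exact hψX _ (by decide) (by decide)
    · rcases ht with rfl | rfl <;> exact hφX _ (by decide) (by decide)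

/-- Both properties pass to products in either argument, which reduces to linear factors.
Coprimality is carried along because `ColonTrivial.mul` consumes it. -/
lemma isRelPrime_and_colonTrivial {K : Ideal S} (hK : HasBinaryForms K) {a b : S}
    (ha : a ∈ Submonoid.closure (linearFactors (X 0) (X 1)))
    (hb : b ∈ Submonoid.closure (linearFactors (X 2) (X 3))) :
    IsRelPrime a b ∧ ColonTrivial K a b := by
  induction ha using Submonoid.closure_induction with
  | one => exact ⟨isRelPrime_one_left, .of_isUnit K isUnit_one b⟩
  | mul x y _ _ hx hy => exact ⟨hx.1.mul_left hy.1, hx.2.mul hx.1 hy.2⟩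
  | mem l hl =>
    rcases hl with hl | hl
    · exact ⟨hl.isRelPrime_left, .of_isUnit K hl b⟩
    · induction hb using Submonoid.closure_induction with
      | one => exact ⟨isRelPrime_one_right, (ColonTrivial.of_isUnit K isUnit_one l).symm⟩
      | mul x y _ _ hx hy =>
        exact ⟨hx.1.mul_right hy.1, (hx.2.symm.mul hx.1.symm hy.2.symm).symm⟩
      | mem m hm =>
        rcases hm with hm | hm
        · exact ⟨hm.isRelPrime_right, (ColonTrivial.of_isUnit K hm l).symm⟩
        · exact isRelPrime_and_colonTrivial_linear hK hl hm

section Contraction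

variable {f : S} {e₁ e₂ e₃ : ℕ} {ρ₁ ρ₂ : AR f} {h : AR f →ₗ[S] S}

/-! ### Splitting the contraction -/

/-- If the image of `h` contains enough binary forms then `h` is surjective. -/
lemma IsContraction.exists_eq_one (hc : IsContraction f e₁ e₂ e₃ ρ₁ ρ₂ h)
    (hK : HasBinaryForms (LinearMap.range h)) : ∃ τ, h τ = 1 := by
  obtain ⟨k, p, hp0, hp, σa, hσa⟩ := hK 0 1 (by decide)
  obtain ⟨l, q, hq0, hq, σb, hσb⟩ := hK 2 3 (by decide)
  have ha0 := binaryForm_ne_zero (i := 0) (j := 1) (by decide) hp0 hp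
  obtain ⟨hrel, hcolon⟩ := isRelPrime_and_colonTrivial hK (binaryForm_mem_closure _ _ hp0 hp)
    (binaryForm_mem_closure _ _ hq0 hq)
  set a := binaryForm (X 0) (X 1) k p
  set b := binaryForm (X 2) (X 3) l q
  obtain ⟨α, β, hαβ⟩ := (hc.eq_zero_iff (b • σa - a • σb)).1 (by
    rw [map_sub, map_smul, map_smul, hσa, hσb, smul_eq_mul, smul_eq_mul, mul_comm, sub_self])
  -- For `c = h σ`, expand `c (b σa - a σb) = b (c σa - a σ) - a (c σb - b σ)`. All three brackets
  -- lie in `ker h`, and comparing coefficients of `ρ₁` and `ρ₂` puts `c α` and `c β` in `(a, b)`.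
  have key : ∀ c ∈ LinearMap.range h, c * α ∈ Ideal.span {a, b} ∧ c * β ∈ Ideal.span {a, b} := by
    rintro _ ⟨σ, rfl⟩
    obtain ⟨α₁, β₁, h₁⟩ := (hc.eq_zero_iff (h σ • σa - a • σ)).1 (by
      rw [map_sub, map_smul, map_smul, hσa, smul_eq_mul, smul_eq_mul, mul_comm, sub_self])
    obtain ⟨α₂, β₂, h₂⟩ := (hc.eq_zero_iff (h σ • σb - b • σ)).1 (by
      rw [map_sub, map_smul, map_smul, hσb, smul_eq_mul, smul_eq_mul, mul_comm, sub_self])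
    have h3 : (h σ * α - b * α₁ + a * α₂) • ρ₁ + (h σ * β - b * β₁ + a * β₂) • ρ₂ = 0 := by
      have h4 : (h σ * α - b * α₁ + a * α₂) • ρ₁ + (h σ * β - b * β₁ + a * β₂) • ρ₂ =
          h σ • (α • ρ₁ + β • ρ₂) - b • (α₁ • ρ₁ + β₁ • ρ₂) + a • (α₂ • ρ₁ + β₂ • ρ₂) := by
        module
      rw [h4, hαβ, h₁, h₂]
      module
    obtain ⟨h5, h6⟩ := hc.independent _ _ h3
    exact ⟨Ideal.mem_span_pair.2 ⟨-α₂, α₁, by linear_combination -h5⟩,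
      Ideal.mem_span_pair.2 ⟨-β₂, β₁, by linear_combination -h6⟩⟩
  obtain ⟨α₁, α₂, hα⟩ := Ideal.mem_span_pair.1 (hcolon α fun c hc' => (key c hc').1)
  obtain ⟨β₁, β₂, hβ⟩ := Ideal.mem_span_pair.1 (hcolon β fun c hc' => (key c hc').2)
  -- Since `α, β ∈ (a, b)`, the lifts of `a` and `b` can be corrected by elements of `ker h` to make
  -- `b σa = a σb` exact. Coprimality then lets `a` be divided out of the corrected lift of `a`,
  -- leaving a syzygy with `h`-value `1`.
  have hdiv : b • (σa - (α₂ • ρ₁ + β₂ • ρ₂)) = a • (σb + (α₁ • ρ₁ + β₁ • ρ₂)) := by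
    rw [← sub_eq_zero]
    have : b • (σa - (α₂ • ρ₁ + β₂ • ρ₂)) - a • (σb + (α₁ • ρ₁ + β₁ • ρ₂)) =
        (b • σa - a • σb) - ((α₁ * a + α₂ * b) • ρ₁ + (β₁ * a + β₂ * b) • ρ₂) := by module
    rw [this, hα, hβ, hαβ, sub_self]
  set σ := σa - (α₂ • ρ₁ + β₂ • ρ₂) with hσ
  have hdvd : ∀ i, a ∣ (σ : Fin 4 → S) i := fun i => by
    have h1 : b * (σ : Fin 4 → S) i = a * _ := congrFun (congrArg Subtype.val hdiv) i
    exact hrel.dvd_of_dvd_mul_left ⟨_, h1⟩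
  choose τ hτ using hdvd
  have hτAR : τ ∈ AR f := by
    rw [mem_AR]
    apply mul_left_cancel₀ ha0
    rw [mul_zero, ← mem_AR.1 σ.2, Finset.mul_sum]
    exact Finset.sum_congr rfl fun i _ => by rw [hτ, mul_assoc]
  refine ⟨⟨τ, hτAR⟩, mul_left_cancel₀ ha0 ?_⟩
  rw [← smul_eq_mul, ← map_smul, show a • (⟨τ, hτAR⟩ : AR f) = σ from
    Subtype.ext (funext fun i => (hτ i).symm), hσ, map_sub, hσa,
    (hc.eq_zero_iff (α₂ • ρ₁ + β₂ • ρ₂)).2 ⟨_, _, rfl⟩, sub_zero, mul_one]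

lemma IsContraction.hasBinaryForms (hc : IsContraction f e₁ e₂ e₃ ρ₁ ρ₂ h) {C N : ℕ}
    (hC : ∀ k, N ≤ k →
      (k + 3).choose 3 ≤ Module.finrank ℂ (contractionComponent h (k + e₃)) + C) :
    HasBinaryForms (LinearMap.range h) := by
  intro i j hij
  -- Degree `N + C` is past the threshold `N` and at least the codimension bound `C`.
  obtain ⟨p, hp0, hp, hpT⟩ := exists_binaryForm_mem hij (hc.le_homogeneousSubmodule (N + C))
    ((hC (N + C) (by omega)).trans (by omega))
  obtain ⟨ρ, -, hρ⟩ := hpT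
  exact ⟨N + C, p, hp0, hp, ρ, hρ⟩

/-- The homogeneous components of a syzygy. -/
def arHomogeneousComponent {d : ℕ} (hf : f.IsHomogeneous d) (k : ℕ) (ρ : AR f) : AR f :=
  ⟨fun i => homogeneousComponent k (ρ.1 i), by
    rw [mem_AR]
    have h1 := congrArg (homogeneousComponent (d - 1 + k)) (mem_AR.1 ρ.2)
    rw [map_sum, map_zero] at h1
    rw [← h1]
    refine Finset.sum_congr rfl fun i _ => ?_
    rw [mul_comm, mul_comm (ρ.1 i), homogeneousComponent_add_mul hf.pderiv]⟩

lemma isHomogeneousVec_arHomogeneousComponent {d : ℕ} (hf : f.IsHomogeneous d) (k : ℕ) (ρ : AR f) :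
    IsHomogeneousVec (arHomogeneousComponent hf k ρ : Fin 4 → S) k := fun _ =>
  homogeneousComponent_isHomogeneous _ _

lemma sum_arHomogeneousComponent {d : ℕ} (hf : f.IsHomogeneous d) (ρ : AR f) :
    ∃ N, ∑ k ∈ Finset.range N, arHomogeneousComponent hf k ρ = ρ := by
  refine ⟨(∑ i, (ρ.1 i).totalDegree) + 1, Subtype.ext (funext fun i => ?_)⟩
  rw [Submodule.coe_sum, Finset.sum_apply]
  refine sum_homogeneousComponent_of_le (Nat.lt_succ_of_le ?_)
  exact Finset.single_le_sum (f := fun i => (ρ.1 i).totalDegree) (fun _ _ => Nat.zero_le _)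
    (Finset.mem_univ i)

/-- Only the degree `e₃` component of `τ` contributes to the constant term of `h τ = 1`. -/
lemma IsContraction.exists_homogeneous (hc : IsContraction f e₁ e₂ e₃ ρ₁ ρ₂ h) {d : ℕ}
    (hf : f.IsHomogeneous d) {τ : AR f} (hτ : h τ = 1) :
    ∃ (σ : AR f) (c : ℂ), c ≠ 0 ∧ IsHomogeneousVec (σ : Fin 4 → S) e₃ ∧ h σ = C c := by
  obtain ⟨N, hN⟩ := sum_arHomogeneousComponent hf τ
  have h1 := congrArg (fun ρ => homogeneousComponent 0 (h ρ)) hN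
  simp only [map_sum, hτ] at h1
  set σ := arHomogeneousComponent hf e₃ τ with hσdef
  have hσ := isHomogeneousVec_arHomogeneousComponent hf e₃ τ
  have hhσ : (h σ).IsHomogeneous 0 := isHomogeneous_of_component fun j hj =>
    hc.graded σ e₃ j hσ (by omega)
  have h2 : h σ = C (coeff 0 (h σ)) := by
    rw [← homogeneousComponent_zero, homogeneousComponent_eq_self hhσ]
  refine ⟨σ, coeff 0 (h σ), fun h0 => ?_, hσ, h2⟩
  rw [Finset.sum_eq_zero, homogeneousComponent_eq_self (isHomogeneous_one _ _)] at h1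
  · exact zero_ne_one h1
  · intro k _
    by_cases hk : k = e₃
    · rw [hk, ← hσdef, h2, h0, C_0, map_zero]
    · exact hc.graded _ k 0 (isHomogeneousVec_arHomogeneousComponent hf k τ) (by omega)

/-- A homogeneous preimage of a nonzero constant splits `h`, so together with `ρ₁, ρ₂` it is a
basis. -/
lemma IsContraction.isFree (hc : IsContraction f e₁ e₂ e₃ ρ₁ ρ₂ h) {d : ℕ}
    (hf : f.IsHomogeneous d) (h₁ : 0 < e₁) (h₁₂ : e₁ ≤ e₂) (h₂₃ : e₂ ≤ e₃) {τ : AR f}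
    (hτ : h τ = 1) : IsFree f := by
  obtain ⟨σ, c, hc0, hσ, hhσ⟩ := hc.exists_homogeneous hf hτ
  have hCc : (C c : S) ≠ 0 := by simpa using hc0
  have hρ₁ : h ρ₁ = 0 := (hc.eq_zero_iff _).2 ⟨1, 0, by simp⟩
  have hρ₂ : h ρ₂ = 0 := (hc.eq_zero_iff _).2 ⟨0, 1, by simp⟩
  have hli : LinearIndependent S ![ρ₁, ρ₂, σ] := by
    rw [Fintype.linearIndependent_iff]
    intro g hg
    simp only [Fin.sum_univ_three, Matrix.cons_val_zero, Matrix.cons_val_one,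
      Matrix.cons_val] at hg
    have h3 := congrArg h hg
    simp only [map_add, map_smul, hρ₁, hρ₂, hhσ, map_zero, smul_eq_mul, mul_zero, zero_add] at h3
    have hg2 := (mul_eq_zero.1 h3).resolve_right hCc
    rw [hg2, zero_smul, add_zero] at hg
    obtain ⟨hg0, hg1⟩ := hc.independent _ _ hg
    intro i
    fin_cases i
    exacts [hg0, hg1, hg2]
  have hsp : ⊤ ≤ Submodule.span S (Set.range ![ρ₁, ρ₂, σ]) := by
    intro ρ _
    obtain ⟨a, b, hab⟩ := (hc.eq_zero_iff (ρ - (h ρ * C c⁻¹) • σ)).1 (by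
      rw [map_sub, map_smul, hhσ, smul_eq_mul, mul_assoc, ← C_mul, inv_mul_cancel₀ hc0, C_1,
        mul_one, sub_self])
    rw [Submodule.mem_span_range_iff_exists_fun]
    refine ⟨![a, b, h ρ * C c⁻¹], ?_⟩
    simp only [Fin.sum_univ_three, Matrix.cons_val_zero, Matrix.cons_val_one,
      Matrix.cons_val]
    rw [hab, sub_add_cancel]
  refine ⟨![e₁, e₂, e₃], Module.Basis.mk hli hsp, ?_, ?_, ?_⟩
  · intro i
    fin_cases i <;> simp <;> omega
  · intro i j hij
    fin_cases i <;> fin_cases j <;> simp at hij ⊢ <;> omega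
  · intro i
    rw [Module.Basis.mk_apply]
    fin_cases i
    exacts [hc.homogeneous₁, hc.homogeneous₂, hσ]

/-! ### Free surfaces -/

/-- Taking degree `q` components of the expansion of `ρ` gives another expansion of `ρ`; coordinates
are unique. -/
lemma repr_homogeneous {n : Fin 3 → ℕ} (b : Module.Basis (Fin 3) S (AR f))
    (hb : ∀ i, IsHomogeneousVec (b i : Fin 4 → S) (n i)) {ρ : AR f} {q : ℕ}
    (hρ : IsHomogeneousVec (ρ : Fin 4 → S) q) (i : Fin 3) :
    b.repr ρ i = if n i ≤ q then homogeneousComponent (q - n i) (b.repr ρ i) else 0 := by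
  have h1 : ∑ i, (if n i ≤ q then homogeneousComponent (q - n i) (b.repr ρ i) else 0) • b i =
      ρ := by
    refine Subtype.ext (funext fun j => ?_)
    rw [← homogeneousComponent_eq_self (hρ j)]
    conv_rhs => rw [← b.sum_repr ρ]
    simp only [Submodule.coe_sum, Submodule.coe_smul, Finset.sum_apply, Pi.smul_apply,
      smul_eq_mul, map_sum]
    refine Finset.sum_congr rfl fun i _ => ?_
    rw [mul_comm (b.repr ρ i), homogeneousComponent_homogeneous_mul (hb i j)]
    split_ifs
    · rw [mul_comm]
    · rw [zero_mul]
  conv_lhs => rw [← h1]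
  rw [b.repr_sum_self]

lemma IsMinimalPair.le (hm : IsMinimalPair f e₁ e₂ ρ₁ ρ₂) : e₁ ≤ e₂ := by
  refine hm.mdr.2 ⟨ρ₂, ρ₂.2, fun h0 => hm.not_mem ?_, hm.homogeneous₂⟩
  rw [show ρ₂ = 0 from Subtype.ext h0]
  exact zero_mem _

/-- The first two exponents of a free surface are the degrees of a minimal pair. -/
lemma IsMinimalPair.exponents_eq (hm : IsMinimalPair f e₁ e₂ ρ₁ ρ₂) {n : Fin 3 → ℕ}
    (hn : Monotone n) (b : Module.Basis (Fin 3) S (AR f))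
    (hb : ∀ i, IsHomogeneousVec (b i : Fin 4 → S) (n i)) : n 0 = e₁ ∧ n 1 = e₂ := by
  have h01 : n 0 ≤ n 1 := hn (by decide)
  have h12 : n 1 ≤ n 2 := hn (by decide)
  have hlow : ∀ {ρ : AR f} {q : ℕ} (i : Fin 3), IsHomogeneousVec (ρ : Fin 4 → S) q → q < n i →
      b.repr ρ i = 0 := fun i hρ hq => by
    rw [repr_homogeneous b hb hρ i, if_neg (by omega)]
  have hb0 : ∀ i, b i ≠ 0 := fun i => b.ne_zero i
  have hn0 : n 0 = e₁ := by
    apply le_antisymm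
    · by_contra! hlt
      apply hm.ne_zero
      rw [← b.sum_repr ρ₁, Fin.sum_univ_three, hlow 0 hm.homogeneous₁ hlt,
        hlow 1 hm.homogeneous₁ (by omega), hlow 2 hm.homogeneous₁ (by omega)]
      simp
    · exact hm.mdr.2 ⟨b 0, (b 0).2, fun h0 => hb0 0 (Subtype.ext h0), hb 0⟩
  refine ⟨hn0, le_antisymm ?_ ?_⟩
  -- If `e₂ < n 1`, both `ρ₁` and `ρ₂` are multiples of `b 0`. As `n 0 = e₁`, the factor for `ρ₁` is
  -- a nonzero constant, so `ρ₂ ∈ S ρ₁`.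
  · by_contra! hlt
    have hle := hm.le
    have hρ₁ : ρ₁ = b.repr ρ₁ 0 • b 0 := by
      conv_lhs => rw [← b.sum_repr ρ₁, Fin.sum_univ_three, hlow 1 hm.homogeneous₁ (by omega),
        hlow 2 hm.homogeneous₁ (by omega), zero_smul, zero_smul, add_zero, add_zero]
    have hρ₂ : ρ₂ = b.repr ρ₂ 0 • b 0 := by
      conv_lhs => rw [← b.sum_repr ρ₂, Fin.sum_univ_three, hlow 1 hm.homogeneous₂ (by omega),
        hlow 2 hm.homogeneous₂ (by omega), zero_smul, zero_smul, add_zero, add_zero]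
    have hconst := repr_homogeneous b hb hm.homogeneous₁ 0
    rw [if_pos hn0.le, hn0, Nat.sub_self, homogeneousComponent_zero] at hconst
    set c := coeff 0 (b.repr ρ₁ 0)
    have hc0 : c ≠ 0 := fun h0 => hm.ne_zero (by rw [hρ₁, hconst, h0, C_0, zero_smul])
    apply hm.not_mem
    rw [Submodule.mem_span_singleton]
    refine ⟨b.repr ρ₂ 0 * C c⁻¹, ?_⟩
    conv_lhs => rw [hρ₁, hconst, smul_smul, mul_assoc, ← C_mul, inv_mul_cancel₀ hc0, C_1, mul_one]
    exact hρ₂.symm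
  -- At least one of `b 0`, `b 1` lies outside `S ρ₁`, since they are independent.
  · by_cases h1 : b 1 ∈ Submodule.span S {ρ₁}
    · refine (hm.minimal (n 0) (b 0) (hb 0) fun h0 => ?_).trans h01
      obtain ⟨s, hs⟩ := Submodule.mem_span_singleton.1 h0
      obtain ⟨t, ht⟩ := Submodule.mem_span_singleton.1 h1
      have hz : t • b 0 + (-s) • b 1 = 0 := by
        rw [← hs, ← ht]
        module
      have hpair := Fintype.linearIndependent_iff.1 b.linearIndependent ![t, -s, 0]
        (by
          simp only [Fin.sum_univ_three, Matrix.cons_val_zero, Matrix.cons_val_one, Matrix.cons_val]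
          rw [zero_smul, add_zero, hz])
      have hs0 : s = 0 := by simpa using hpair 1
      exact hb0 0 (by rw [← hs, hs0, zero_smul])
    · exact hm.minimal (n 1) (b 1) (hb 1) h1

/-- For a free surface the image of the contraction has the Hilbert function of a shift of `S`. -/
lemma IsContraction.exists_finrank_of_isFree (hc : IsContraction f e₁ e₂ e₃ ρ₁ ρ₂ h)
    (hm : IsMinimalPair f e₁ e₂ ρ₁ ρ₂) (hfree : IsFree f) :
    ∃ n, ∀ k, e₁ ≤ k → e₂ ≤ k → n ≤ k →
      Module.finrank ℂ (contractionComponent h k) = (k - n + 3).choose 3 := by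
  obtain ⟨n, b, -, hmono, hb⟩ := hfree
  obtain ⟨h0, h1⟩ := hm.exponents_eq hmono b hb
  refine ⟨n 2, fun k hk₁ hk₂ hk₃ => ?_⟩
  have h2 := hc.finrank_arComponent hk₁ hk₂
  have h3 := finrank_arComponent_inf_span b.linearIndependent hb (k := k)
    (by intro i; fin_cases i; exacts [h0.trans_le hk₁, h1.trans_le hk₂, hk₃])
  rw [b.span_eq, Submodule.restrictScalars_top, inf_top_eq, Fin.sum_univ_three, h0, h1] at h3
  omega

end Contraction

/-! ### Numerical computations -/

lemma cast_choose_three (k : ℕ) :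
    (((k + 3).choose 3 : ℕ) : ℚ) = ((k : ℚ) + 1) * (k + 2) * (k + 3) / 6 := by
  induction k with
  | zero => norm_num
  | succ k ih =>
    have h2 : (((k + 3).choose 2 : ℕ) : ℚ) = ((k : ℚ) + 3) * (k + 2) / 2 := by
      rw [Nat.cast_choose_two]
      push_cast
      ring
    rw [show k + 1 + 3 = (k + 3) + 1 by ring, Nat.choose_succ_succ' (k + 3) 2, Nat.cast_add, ih, h2]
    push_cast
    ring

lemma cast_choose_three_sub {k e : ℕ} (h : e ≤ k) :
    (((k - e + 3).choose 3 : ℕ) : ℚ) = ((k : ℚ) - e + 1) * (k - e + 2) * (k - e + 3) / 6 := by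
  rw [cast_choose_three, Nat.cast_sub h]

open Filter in
/-- A polynomial squeezed between `0` and a linear function has degree at most one. -/
lemma natDegree_le_one_of_le {P : Polynomial ℚ} {α β : ℚ} {N : ℕ}
    (h : ∀ k : ℕ, N ≤ k → 0 ≤ P.eval (k : ℚ) ∧ P.eval (k : ℚ) ≤ α * k + β) : P.natDegree ≤ 1 := by
  by_contra! hdeg
  have hcast := tendsto_natCast_atTop_atTop (R := ℚ)
  rcases le_total 0 P.leadingCoeff with hlc | hlc
  · set l : Polynomial ℚ := Polynomial.C α * Polynomial.X + Polynomial.C β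
    have hl : l.degree < P.degree := by
      refine lt_of_le_of_lt Polynomial.degree_linear_le ?_
      rw [Polynomial.degree_eq_natDegree (by rintro rfl; simp at hdeg)]
      exact_mod_cast hdeg
    have hd : (P - l).degree = P.degree := Polynomial.degree_sub_eq_left_of_degree_lt hl
    have hc : (P - l).leadingCoeff = P.leadingCoeff :=
      Polynomial.leadingCoeff_sub_of_degree_lt hl
    have ht := (Polynomial.tendsto_atTop_of_leadingCoeff_nonneg (P - l)
      (by rw [hd]; exact Polynomial.natDegree_pos_iff_degree_pos.1 (by omega))
      (by rw [hc]; exact hlc)).comp hcast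
    obtain ⟨k, hk1, hk2⟩ := ((ht.eventually_gt_atTop 0).and (eventually_ge_atTop N)).exists
    have := (h k hk2).2
    simp [l] at hk1
    linarith
  · have ht := (Polynomial.tendsto_atBot_of_leadingCoeff_nonpos P
      (Polynomial.natDegree_pos_iff_degree_pos.1 (by omega)) hlc).comp hcast
    obtain ⟨k, hk1, hk2⟩ := ((ht.eventually_lt_atBot 0).and (eventually_ge_atTop N)).exists
    exact absurd (h k hk2).1 (not_le.2 hk1)

/-- Linear functions are compared by their slopes. -/
lemma slope_le_of_forall_le {a b α β : ℚ} {N : ℕ}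
    (h : ∀ k : ℕ, N ≤ k → a * k + b ≤ α * k + β) : a ≤ α := by
  by_contra! hlt
  obtain ⟨n, hn⟩ := exists_nat_gt ((β - b) / (a - α))
  have h1 := h (n + N) (by omega)
  rw [div_lt_iff₀ (by linarith)] at hn
  push_cast at h1
  have h2 : 0 ≤ (a - α) * N := mul_nonneg (by linarith) (Nat.cast_nonneg N)
  nlinarith

end FreeSurface

end

/-! ### The degree bound and the case of equality -/

open FreeSurface in
theorem theorem1p3 (f : FreeSurface.S) (d e₁ e₂ e₃ : ℕ)
    (hf : f.IsHomogeneous d)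
    (hred : Squarefree f)
    (hdim : topologicalKrullDim (FreeSurface.singularLocus f) = 1)
    (hmdr : 0 < e₁)
    (htame : FreeSurface.IsTame f e₁ e₂)
    (hle : e₁ + 2 * e₂ + 1 ≤ d)
    (he₃ : e₁ + e₂ + e₃ + 1 = d) :
    ∃ δ : ℚ, FreeSurface.IsSingularDegree f δ ∧
      δ ≤ ((e₁ : ℚ) + e₂ + e₃) ^ 2 - (e₁ * e₂ + e₁ * e₃ + e₂ * e₃) ∧
      (δ = ((e₁ : ℚ) + e₂ + e₃) ^ 2 - (e₁ * e₂ + e₁ * e₃ + e₂ * e₃) ↔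
        FreeSurface.IsFree f) := by
  obtain ⟨ρ₁, ρ₂, hm, hex⟩ := htame
  obtain ⟨h, hc⟩ := exists_contraction_of_exact hf hred he₃ hm.homogeneous₁ hm.homogeneous₂ hex
  set D := e₁ + e₂ + e₃ with hD
  have hfD : f.IsHomogeneous (D + 1) := he₃ ▸ hf
  obtain ⟨P, N, hP⟩ := eventuallyPolynomial_hilbertFunction _ (isHomogeneousIdeal_jacobianIdeal hf)
  set s : ℚ := ((e₁ : ℚ) + e₂ + e₃) ^ 2 - (e₁ * e₂ + e₁ * e₃ + e₂ * e₃) with hs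
  have hslope : ∃ β : ℚ, ∀ k : ℕ, D + N ≤ k → P.eval ((D + k : ℕ) : ℚ) +
      (((k - e₃ + 3).choose 3 : ℕ) - (Module.finrank ℂ (contractionComponent h k) : ℚ)) =
        s * ((D + k : ℕ) : ℚ) + β := by
    let H : ℚ → ℚ := fun y => (y + 1) * (y + 2) * (y + 3) / 6
    -- `H` is the polynomial giving `dim S_y`. The left side is `H(D+k) - 4H(k) + ∑ H(k-eᵢ)`: its
    -- cubic terms cancel, its quadratic terms cancel because `D = e₁ + e₂ + e₃`, and `β` is read
    -- off at `k = 0`.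
    refine ⟨H D - 4 * H 0 + H (-e₁) + H (-e₂) + H (-e₃) - s * D, fun k hk => ?_⟩
    have h1 := congrArg (Nat.cast (R := ℚ))
      (hc.hilbertFunction_add hfD (k := k) (by omega) (by omega))
    push_cast at h1
    rw [hP _ (by omega), cast_choose_three_sub (by omega), cast_choose_three_sub (by omega),
      cast_choose_three, cast_choose_three] at h1
    rw [cast_choose_three_sub (by omega)]
    simp only [H, hs, hD] at h1 ⊢
    push_cast at h1 ⊢
    linear_combination h1
  obtain ⟨β, hβ⟩ := hslope
  have hdefect : ∀ k, D ≤ k → (Module.finrank ℂ (contractionComponent h k) : ℚ) ≤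
      ((k - e₃ + 3).choose 3 : ℕ) := fun k hk => by
    have h1 := Submodule.finrank_mono (hc.le_homogeneousSubmodule (k - e₃))
    rw [finrank_homogeneousSubmodule, Nat.sub_add_cancel (by omega)] at h1
    exact_mod_cast h1
  have hPle : ∀ j : ℕ, D + (D + N) ≤ j → 0 ≤ P.eval (j : ℚ) ∧ P.eval (j : ℚ) ≤ s * j + β := by
    intro j hj
    obtain ⟨k, rfl⟩ : ∃ k, j = D + k := ⟨j - D, by omega⟩
    have h1 := hβ k (by omega)
    have h2 := hdefect k (by omega)
    refine ⟨?_, by linarith⟩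
    rw [← hP _ (by omega)]
    exact Nat.cast_nonneg _
  have hdeg : P.natDegree = 1 := by
    refine le_antisymm (natDegree_le_one_of_le hPle) ?_
    by_contra! h0
    rw [Polynomial.eq_C_of_natDegree_le_zero (by omega : P.natDegree ≤ 0)] at hP
    obtain ⟨C, hC⟩ := exists_nat_gt (P.coeff 0)
    obtain ⟨k, hk, hCk⟩ := hilbertFunction_unbounded hdim.ge C N
    have h1 := hP k hk
    rw [Polynomial.eval_C] at h1
    have h2 : (C : ℚ) ≤ hilbertFunction (jacobianIdeal f) k := by exact_mod_cast hCk
    linarith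
  set a := P.coeff 1
  set b := P.coeff 0
  have hPeval : ∀ x : ℚ, P.eval x = a * x + b := fun x => by
    rw [Polynomial.eq_X_add_C_of_natDegree_le_one hdeg.le]
    simp [a, b]
  simp only [hPeval] at hβ hPle
  refine ⟨a, ⟨P, ⟨N, hP⟩, ?_⟩, slope_le_of_forall_le fun k hk => (hPle k hk).2, ?_, ?_⟩
  · rw [Polynomial.leadingCoeff, hdeg]
    simp [a]
  · intro has
    -- With equal slopes the codimension of the image of `h` is the constant `β - b`.
    obtain ⟨C, hC⟩ := exists_nat_ge (β - b)
    have hK := hc.hasBinaryForms (C := C) (N := D + N) fun k hk => by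
      have h1 := hβ (k + e₃) (by omega)
      rw [has, Nat.add_sub_cancel] at h1
      have h2 : (((k + 3).choose 3 : ℕ) : ℚ) ≤
          (Module.finrank ℂ (contractionComponent h (k + e₃)) : ℚ) + C := by linarith
      exact_mod_cast h2
    obtain ⟨τ, hτ⟩ := hc.exists_eq_one hK
    -- The bound `e₁ + 2e₂ ≤ d - 1` amounts to `e₂ ≤ e₃`, the order required of the exponents.
    exact hc.isFree hf hmdr hm.le (by omega) hτ
  · intro hfree
    obtain ⟨n, hn⟩ := hc.exists_finrank_of_isFree hm hfree
    have hlin : ∀ k : ℕ, D + N + n ≤ k → ((k : ℚ) - e₃ + 1) * (k - e₃ + 2) * (k - e₃ + 3) / 6 -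
        ((k : ℚ) - n + 1) * (k - n + 2) * (k - n + 3) / 6 =
          (s - a) * ((D : ℚ) + k) + (β - b) := fun k hk => by
      have h1 := hβ k (by omega)
      rw [hn k (by omega) (by omega) (by omega), cast_choose_three_sub (by omega),
        cast_choose_three_sub (by omega)] at h1
      push_cast at h1
      linear_combination h1
    set M := D + N + n
    have h0 := hlin M le_rfl
    have h1 := hlin (M + 1) (by omega)
    have h2 := hlin (M + 2) (by omega)
    push_cast at h1 h2
    -- The second difference of the right side is zero and that of the left side is `n - e₃`. Once
    -- `n = e₃`, the first difference gives `a = s`.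
    have hne : (e₃ : ℚ) = n := by linear_combination 2 * h1 - h2 - h0
    rw [hne] at h0 h1
    linear_combination h1 - h0
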